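/- Let $K$ be a non-archimedean local field with ring of integers $O$, a uniformizer $\pi$ and finite residue field $\mathbb F_q=O/(\pi)$; fix a set of representatives of $\mathbb F_q$ in $O$, through which elements of $\mathbb F_q$ are regarded as elements of $O$. Let $r\ge 2$ and let $R$ be an abelian group. **The building.** Let $V=K^r$ (row vectors). Vertices of the Bruhat–Tits building $\mathcal B$ of $\mathrm{PGL}_r(K)$ are the classes $[L]$ of $O$-lattices $L\subset V$ up to scaling by $K^\times$. The set of oriented edges is $\mathrm{Ed}=\{([L_0],[L_1]) : L_0\supsetneq L_1\supsetneq \pi L_0\}$. Such an edge $e$ has origin $[L_0]$, terminus $t(e)=[L_1]$, reverse $\bar e=([L_1],[L_0])$ and type $\dim_{\mathbb F_q}(L_0/L_1)\in\{1,\dots,r-1\}$. The group $\mathrm{GL}_r(K)$ acts on lattices by $g\cdot L=Lg^{-1}$, hence on vertices and on edges. **Harmonic cochains.** $\mathrm{Har}^1(\mathcal B,R)$ is the group of functions $h:\mathrm{Ed}\to R$ such that 1. $h(e)=-h(\bar e)$ for all $e\in\mathrm{Ed}$; 2. for every vertex $v$ and every $1\le s\le r-1$, $\sum_e h(e)=0$,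 the sum being over the edges $e$ of type $s$ with $t(e)=v$; 3. for every edge $e=([L_0],[L_1])$ with $L_0\supsetneq L_1\supsetneq\pi L_0$, $\sum_{e'}h(e')=h(e)$, the sum being over the edges $e'=([L_0'],[L_1])$ of type $1$ with $L_0\supseteq L_0'\supsetneq L_1$; 4. $h([L_0],[L_1])+h([L_1],[L_2])=h([L_0],[L_2])$ whenever $L_0\supsetneq L_1\supsetneq L_2\supsetneq\pi L_0$. $\mathrm{GL}_r(K)$ acts on it by $(\gamma h)(e)=h(\gamma^{-1}e)$. **Functions on the group.** Let $\mathcal I^1\subset \mathrm{GL}_r(O)$ be the subgroup of matrices whose entries in the first column below the diagonal lie in $\pi O$, let $\Lambda_0=O^r$, and let $e^1=([\Lambda_0],[\Lambda_0\,\mathrm{diag}(\pi,1,\dots,1)])$, an edge of type $1$. For $h\in\mathrm{Har}^1(\mathcal B,R)$ put $h_1(g)=h(g e^1)$ for $g\in \mathrm{GL}_r(K)$. Let $\mathcal H$ be the group of functions $f:\mathrm{GL}_r(K)/K^\times\mathcal I^1\to R$ such that, for all $g\in\mathrm{GL}_r(K)$, $$\sum_{\vec u\in\mathbb F_q^{s-1}}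 f\left(g\begin{pmatrix}\pi&\vec u&\\&I_{s-1}&\\&&I_{r-s}\end{pmatrix}\right)=f\left(g\begin{pmatrix}\pi I_s&\\&I_{r-s}\end{pmatrix}\right)\qquad(1\le s\le r)$$ and $$\sum_{1\le s\le r} f\left(g\begin{pmatrix}&I_{r-s}\\ \pi I_s&\end{pmatrix}\right)=0,$$ with $\mathrm{GL}_r(K)$ acting by $(\gamma f)(x)=f(\gamma^{-1}x)$. **Proposition.** The map $h\mapsto h_1$ is a well-defined $\mathrm{GL}_r(K)$-equivariant isomorphism of abelian groups from $\mathrm{Har}^1(\mathcal B,R)$ onto $\mathcal H$. -/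

import Mathlib

open scoped ValuativeRel Pointwise Matrix

noncomputable section

namespace BruhatTits

section Building

variable {K : Type*} [Field K] [ValuativeRel K]

/-- An `O`-lattice in the space `K ^ r` of row vectors: a finitely generated `O`-submodule spanning
`K ^ r` over `K` (as `O` is a principal ideal domain, this is the same as a free `O`-submodule of
rank `r` that contains a `K`-basis). -/
def OLattice (K : Type*) [Field K] [ValuativeRel K] (r : ℕ) : Type _ :=
  {L : Submodule 𝒪[K] (Fin r → K) // L.IsLattice K}

/-- The `O`-linear map `x ↦ x g` on row vectors. -/
def rowMul {r : ℕ} (g : GL (Fin r) K) : (Fin r → K) →ₗ[𝒪[K]] (Fin r → K) :=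
  (Matrix.vecMulLinear (g : Matrix (Fin r) (Fin r) K)).restrictScalars 𝒪[K]

theorem rowMul_apply {r : ℕ} (g : GL (Fin r) K) (x : Fin r → K) :
    rowMul g x = x ᵥ* (g : Matrix (Fin r) (Fin r) K) := rfl

theorem rowMul_mul {r : ℕ} (g g' : GL (Fin r) K) (x : Fin r → K) :
    rowMul (g * g') x = rowMul g' (rowMul g x) := by
  simp [rowMul_apply, Matrix.vecMul_vecMul]

theorem rowMul_one {r : ℕ} (x : Fin r → K) : rowMul (1 : GL (Fin r) K) x = x := by
  simp [rowMul_apply]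

theorem rowMul_smul {r : ℕ} (g : GL (Fin r) K) (a : K) (x : Fin r → K) :
    rowMul g (a • x) = a • rowMul g x := by
  simp [rowMul_apply, Matrix.smul_vecMul]

theorem rowMul_inv_rowMul {r : ℕ} (g : GL (Fin r) K) (x : Fin r → K) :
    rowMul g⁻¹ (rowMul g x) = x := by
  rw [← rowMul_mul, mul_inv_cancel, rowMul_one]

theorem rowMul_rowMul_inv {r : ℕ} (g : GL (Fin r) K) (x : Fin r → K) :
    rowMul g (rowMul g⁻¹ x) = x := by
  rw [← rowMul_mul, inv_mul_cancel, rowMul_one]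

theorem rowMul_injective {r : ℕ} (g : GL (Fin r) K) : Function.Injective (rowMul g) :=
  Function.LeftInverse.injective (rowMul_inv_rowMul g)

/-- The right action of `GL_r(K)` on lattices, `L ↦ L g`. -/
def OLattice.mulRight {r : ℕ} (L : OLattice K r) (g : GL (Fin r) K) : OLattice K r :=
  ⟨L.1.map (rowMul g), by
    obtain ⟨hfg, hspan⟩ := L.2
    refine ⟨hfg.map _, ?_⟩
    rw [eq_top_iff]
    rintro x -
    have hx : rowMul g⁻¹ x ∈ Submodule.span K (L.1 : Set (Fin r → K)) := by
      rw [hspan]; trivial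
    have key : ∀ y ∈ Submodule.span K (L.1 : Set (Fin r → K)),
        rowMul g y ∈ Submodule.span K ((L.1.map (rowMul g) : Submodule 𝒪[K] (Fin r → K)) :
          Set (Fin r → K)) := by
      intro y hy
      induction hy using Submodule.span_induction with
      | mem y hy => exact Submodule.subset_span (Submodule.mem_map_of_mem hy)
      | zero => simp
      | add y z _ _ hy hz => rw [map_add]; exact add_mem hy hz
      | smul a y _ hy => rw [rowMul_smul]; exact Submodule.smul_mem _ _ hy
    have := key _ hx
    rwa [rowMul_rowMul_inv] at this⟩

/-- The left action of `GL_r(K)` on lattices: `g • L = L g⁻¹`. -/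
instance {r : ℕ} : MulAction (GL (Fin r) K) (OLattice K r) where
  smul g L := L.mulRight g⁻¹
  one_smul L := by
    apply Subtype.ext
    ext x
    change x ∈ L.1.map (rowMul 1⁻¹) ↔ x ∈ L.1
    simp [Submodule.mem_map, rowMul_one]
  mul_smul g g' L := by
    apply Subtype.ext
    ext x
    change x ∈ L.1.map (rowMul (g * g')⁻¹) ↔ x ∈ (L.1.map (rowMul g'⁻¹)).map (rowMul g⁻¹)
    simp [Submodule.mem_map, rowMul_mul]

theorem OLattice.smul_val {r : ℕ} (g : GL (Fin r) K) (L : OLattice K r) :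
    (g • L).1 = L.1.map (rowMul g⁻¹) := rfl

/-- Two lattices are similar if `α L₁ = L₂` for some `α ∈ Kˣ`. -/
instance similar (K : Type*) [Field K] [ValuativeRel K] (r : ℕ) : Setoid (OLattice K r) where
  r L₁ L₂ := ∃ α : Kˣ, α • L₁.1 = L₂.1
  iseqv :=
    { refl := fun L => ⟨1, one_smul _ _⟩
      symm := by
        rintro L₁ L₂ ⟨α, h⟩
        exact ⟨α⁻¹, by rw [← h, inv_smul_smul]⟩
      trans := by
        rintro L₁ L₂ L₃ ⟨α, h⟩ ⟨β, h'⟩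
        exact ⟨β * α, by rw [mul_smul, h, h']⟩ }

/-- The vertices of the building: similarity classes of lattices. -/
def Vertex (K : Type*) [Field K] [ValuativeRel K] (r : ℕ) : Type _ :=
  Quotient (similar K r)

/-- The vertex `[L]`. -/
def OLattice.cls {r : ℕ} (L : OLattice K r) : Vertex K r := Quotient.mk _ L

theorem map_rowMul_smul {r : ℕ} (g : GL (Fin r) K) (α : Kˣ)
    (L : Submodule 𝒪[K] (Fin r → K)) :
    (α • L).map (rowMul g) = α • L.map (rowMul g) := by
  ext x
  simp only [Submodule.mem_map]
  constructor
  · rintro ⟨_, ⟨y, hy, rfl⟩, rfl⟩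
    exact ⟨_, ⟨y, hy, rfl⟩, (rowMul_smul g (α : K) y).symm⟩
  · rintro ⟨_, ⟨y, hy, rfl⟩, rfl⟩
    exact ⟨_, ⟨y, hy, rfl⟩, rowMul_smul g (α : K) y⟩

/-- The left action of `GL_r(K)` on vertices: `g • [L] = [L g⁻¹]`. -/
instance {r : ℕ} : MulAction (GL (Fin r) K) (Vertex K r) where
  smul g := Quotient.map (fun L => g • L) (by
    rintro L₁ L₂ ⟨α, h⟩
    refine ⟨α, ?_⟩
    rw [OLattice.smul_val, OLattice.smul_val, ← map_rowMul_smul, h])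
  one_smul v := by
    induction v using Quotient.inductionOn with
    | h L => exact congrArg OLattice.cls (one_smul (GL (Fin r) K) L)
  mul_smul g g' v := by
    induction v using Quotient.inductionOn with
    | h L => exact congrArg OLattice.cls (mul_smul g g' L)

theorem smul_cls {r : ℕ} (g : GL (Fin r) K) (L : OLattice K r) : g • L.cls = (g • L).cls := rfl

/-- `Adj π L₀ L₁` means `L₀ ⊋ L₁ ⊋ π L₀`. -/
def Adj (π : 𝒪[K]) {r : ℕ} (L₀ L₁ : OLattice K r) : Prop :=
  L₁.1 < L₀.1 ∧ π • L₀.1 < L₁.1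

theorem lt_smul {r : ℕ} {L M : Submodule 𝒪[K] (Fin r → K)} (g : GL (Fin r) K) (h : L < M) :
    L.map (rowMul g) < M.map (rowMul g) :=
  (Submodule.map_strictMono_of_injective (rowMul_injective g)) h

theorem map_rowMul_smul_int {r : ℕ} (g : GL (Fin r) K) (π : 𝒪[K])
    (L : Submodule 𝒪[K] (Fin r → K)) :
    (π • L).map (rowMul g) = π • L.map (rowMul g) := by
  ext x
  simp only [Submodule.mem_map, Submodule.mem_smul_pointwise_iff_exists]
  constructor
  · rintro ⟨_, ⟨y, hy, rfl⟩, rfl⟩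
    exact ⟨_, ⟨y, hy, rfl⟩, (map_smul (rowMul g) π y).symm⟩
  · rintro ⟨_, ⟨y, hy, rfl⟩, rfl⟩
    exact ⟨_, ⟨y, hy, rfl⟩, map_smul (rowMul g) π y⟩

theorem Adj.smul {π : 𝒪[K]} {r : ℕ} {L₀ L₁ : OLattice K r} (h : Adj π L₀ L₁)
    (g : GL (Fin r) K) : Adj π (g • L₀) (g • L₁) := by
  refine ⟨lt_smul _ h.1, ?_⟩
  have := lt_smul g⁻¹ h.2
  rwa [map_rowMul_smul_int] at this

/-- The residue field `F_q = O / (π)`. -/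
abbrev ResField (π : 𝒪[K]) : Type _ := 𝒪[K] ⧸ Ideal.span {π}

/-- For `L₀ ⊇ L₁ ⊇ π L₀` the quotient `L₀ / L₁` is annihilated by `π`, so that it is a vector space
over `F_q = O / (π)`. -/
abbrev quotModule (π : 𝒪[K]) {r : ℕ} (L₀ L₁ : OLattice K r) (h : π • L₀.1 ≤ L₁.1) :
    Module (ResField π) (L₀.1 ⧸ L₁.1.submoduleOf L₀.1) :=
  Module.IsTorsionBySet.module ((Module.isTorsionBySet_span_singleton_iff π).mpr (by
    intro x
    induction x using Submodule.Quotient.induction_on with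
    | H x =>
      rw [← Submodule.Quotient.mk_smul, Submodule.Quotient.mk_eq_zero]
      exact h (Submodule.smul_mem_pointwise_smul _ _ _ x.2)))

/-- `dim_{F_q} (L₀ / L₁)` for lattices `L₀ ⊇ L₁ ⊇ π L₀`. -/
def quotDim (π : 𝒪[K]) {r : ℕ} (L₀ L₁ : OLattice K r) (h : π • L₀.1 ≤ L₁.1) : ℕ :=
  letI := quotModule π L₀ L₁ h
  Module.finrank (ResField π) (L₀.1 ⧸ L₁.1.submoduleOf L₀.1)

/-- The oriented edges of the building: the pairs `([L₀], [L₁])` with `L₀ ⊋ L₁ ⊋ π L₀`. -/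
def OrientedEdge (π : 𝒪[K]) (r : ℕ) : Type _ :=
  {e : Vertex K r × Vertex K r //
    ∃ L₀ L₁ : OLattice K r, L₀.cls = e.1 ∧ L₁.cls = e.2 ∧ Adj π L₀ L₁}

namespace OrientedEdge

variable {π : 𝒪[K]} {r : ℕ}

/-- The origin of an oriented edge. -/
def origin (e : OrientedEdge π r) : Vertex K r := e.1.1

/-- The terminus of an oriented edge. -/
def terminus (e : OrientedEdge π r) : Vertex K r := e.1.2

/-- The oriented edge `([L₀], [L₁])`. -/
def mk (L₀ L₁ : OLattice K r) (h : Adj π L₀ L₁) : OrientedEdge π r :=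
  ⟨(L₀.cls, L₁.cls), L₀, L₁, rfl, rfl, h⟩

/-- `e` has type `s`: `e = ([L₀], [L₁])` with `L₀ ⊋ L₁ ⊋ π L₀` and `dim_{F_q} (L₀ / L₁) = s`. -/
def HasType (e : OrientedEdge π r) (s : ℕ) : Prop :=
  ∃ (L₀ L₁ : OLattice K r) (h : Adj π L₀ L₁), e = mk L₀ L₁ h ∧ quotDim π L₀ L₁ h.2.le = s

/-- The set of oriented edges of type `s` with terminus `v`. -/
def typeTerminus (s : ℕ) (v : Vertex K r) : Set (OrientedEdge π r) :=
  {e | e.HasType s ∧ e.terminus = v}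

/-- For `e = ([L₀], [L₁])` with `L₀ ⊋ L₁ ⊋ π L₀`, the set of edges `e' = ([L₀'], [L₁])` of type `1`
with `L₀ ⊇ L₀' ⊇ L₁`. -/
def triangle (e : OrientedEdge π r) : Set (OrientedEdge π r) :=
  {e' | e'.HasType 1 ∧ ∃ (L₀ L₀' L₁ : OLattice K r) (h : Adj π L₀ L₁) (h' : Adj π L₀' L₁),
    e = mk L₀ L₁ h ∧ e' = mk L₀' L₁ h' ∧ L₀'.1 ≤ L₀.1}

/-- The left action of `GL_r(K)` on oriented edges. -/
instance : MulAction (GL (Fin r) K) (OrientedEdge π r) where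
  smul g e := ⟨(g • e.1.1, g • e.1.2), by
    obtain ⟨L₀, L₁, h₀, h₁, h⟩ := e.2
    exact ⟨g • L₀, g • L₁, by rw [← smul_cls, h₀], by rw [← smul_cls, h₁], h.smul g⟩⟩
  one_smul e := Subtype.ext (Prod.ext (one_smul _ _) (one_smul _ _))
  mul_smul g g' e := Subtype.ext (Prod.ext (mul_smul _ _ _) (mul_smul _ _ _))

theorem smul_mk (g : GL (Fin r) K) (L₀ L₁ : OLattice K r) (h : Adj π L₀ L₁) :
    g • mk L₀ L₁ h = mk (g • L₀) (g • L₁) (h.smul g) := rfl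

theorem quotDim_smul (g : GL (Fin r) K) (L₀ L₁ : OLattice K r) (h : Adj π L₀ L₁) :
    quotDim π (g • L₀) (g • L₁) (h.smul g).2.le = quotDim π L₀ L₁ h.2.le := by
  unfold quotDim
  let E : L₀.1 ≃ₗ[𝒪[K]] (g • L₀).1 := Submodule.equivMapOfInjective (rowMul g⁻¹)
    (rowMul_injective _) L₀.1
  have hE : (L₁.1.submoduleOf L₀.1).map (E : L₀.1 →ₗ[𝒪[K]] (g • L₀).1) =
      (g • L₁).1.submoduleOf (g • L₀).1 := by
    ext ⟨x, hx⟩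
    constructor
    · rintro ⟨y, hy, hyx⟩
      exact ⟨y.1, hy, congrArg Subtype.val hyx⟩
    · rintro ⟨y, hy, hyx⟩
      exact ⟨⟨y, h.1.le hy⟩, hy, Subtype.ext hyx⟩
  let F := Submodule.Quotient.equiv _ _ E hE
  symm
  letI := quotModule π L₀ L₁ h.2.le
  letI := quotModule π (g • L₀) (g • L₁) (h.smul g).2.le
  refine congrArg Cardinal.toNat (rank_eq_of_equiv_equiv id F.toAddEquiv Function.bijective_id ?_)
  intro a m
  obtain ⟨a, rfl⟩ := Ideal.Quotient.mk_surjective a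
  exact map_smul F a m

theorem HasType.smul {e : OrientedEdge π r} {s : ℕ} (h : e.HasType s) (g : GL (Fin r) K) :
    (g • e).HasType s := by
  obtain ⟨L₀, L₁, h, rfl, hs⟩ := h
  exact ⟨g • L₀, g • L₁, h.smul g, rfl, (quotDim_smul g L₀ L₁ h).trans hs⟩

theorem smul_mem_typeTerminus {e : OrientedEdge π r} {s : ℕ} {v : Vertex K r}
    (h : e ∈ typeTerminus s v) (g : GL (Fin r) K) : g • e ∈ typeTerminus s (g • v) :=
  ⟨h.1.smul g, congrArg (g • ·) h.2⟩

theorem smul_mem_triangle {e e' : OrientedEdge π r} (h : e' ∈ triangle e) (g : GL (Fin r) K) :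
    g • e' ∈ triangle (g • e) := by
  obtain ⟨h1, L₀, L₀', L₁, h, h', rfl, rfl, hle⟩ := h
  exact ⟨h1.smul g, g • L₀, g • L₀', g • L₁, h.smul g, h'.smul g, rfl, rfl,
    Submodule.map_mono hle⟩

end OrientedEdge

theorem units_smul_mono {r : ℕ} (α : Kˣ) {L M : Submodule 𝒪[K] (Fin r → K)} (h : L ≤ M) :
    α • L ≤ α • M :=
  Submodule.map_mono h

theorem uniformizer_ne_zero {π : 𝒪[K]} (hπ : Irreducible π) : (π : K) ≠ 0 := by
  intro h
  exact hπ.ne_zero (Subtype.ext h)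

/-- A uniformizer `π`, as an element of `Kˣ`. -/
def unif {π : 𝒪[K]} (hπ : Irreducible π) : Kˣ := Units.mk0 (π : K) (uniformizer_ne_zero hπ)

theorem smul_lt_smul_unif {π : 𝒪[K]} (hπ : Irreducible π) {r : ℕ}
    {L M : Submodule 𝒪[K] (Fin r → K)} (h : L < M) : π • L < π • M := by
  have e : ∀ N : Submodule 𝒪[K] (Fin r → K), π • N = unif hπ • N := fun N => rfl
  rw [e, e]
  refine lt_of_le_not_ge (Submodule.map_mono h.le) fun h' => h.not_ge ?_
  have := units_smul_mono (unif hπ)⁻¹ h'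
  rwa [inv_smul_smul, inv_smul_smul] at this

/-- The edge `e` with the reverse orientation, `(v₁, v₀)` for `e = (v₀, v₁)`. -/
def OrientedEdge.reverse {π : 𝒪[K]} (hπ : Irreducible π) {r : ℕ} (e : OrientedEdge π r) :
    OrientedEdge π r :=
  ⟨(e.1.2, e.1.1), by
    obtain ⟨L₀, L₁, h₀, h₁, h⟩ := e.2
    have := L₀.2
    refine ⟨L₁, ⟨unif hπ • L₀.1, inferInstance⟩, h₁, ?_, h.2, smul_lt_smul_unif hπ h.1⟩
    rw [← h₀]
    exact Quotient.sound ⟨(unif hπ)⁻¹, inv_smul_smul _ _⟩⟩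

end Building

section Finiteness

variable {K : Type*} [Field K] [ValuativeRel K] [TopologicalSpace K] [IsNonarchimedeanLocalField K]

theorem finite_resField {π : 𝒪[K]} (hπ : Irreducible π) : Finite (ResField π) := by
  have h : Ideal.span {π} = IsLocalRing.maximalIdeal 𝒪[K] := hπ.maximalIdeal_eq.symm
  have : Finite (𝒪[K] ⧸ IsLocalRing.maximalIdeal 𝒪[K]) := inferInstanceAs (Finite 𝓀[K])
  unfold ResField
  rw [h]
  exact this

/-- There are only finitely many submodules between `L` and `P` when `π P ≤ L`. -/
theorem finite_between {π : 𝒪[K]} (hπ : Irreducible π) {r : ℕ}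
    (L P : Submodule 𝒪[K] (Fin r → K)) [hP : P.IsLattice K] (h : π • P ≤ L) :
    {M : Submodule 𝒪[K] (Fin r → K) | L ≤ M ∧ M ≤ P}.Finite := by
  have htors : Module.IsTorsionBySet 𝒪[K] (P ⧸ L.submoduleOf P) (Ideal.span {π}) :=
    (Module.isTorsionBySet_span_singleton_iff π).mpr (by
      intro x
      induction x using Submodule.Quotient.induction_on with
      | H x =>
        rw [← Submodule.Quotient.mk_smul, Submodule.Quotient.mk_eq_zero]
        exact h (Submodule.smul_mem_pointwise_smul _ _ _ x.2))
  letI : Module (ResField π) (P ⧸ L.submoduleOf P) := Module.IsTorsionBySet.module htors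
  have : IsScalarTower 𝒪[K] (ResField π) (P ⧸ L.submoduleOf P) :=
    Module.IsTorsionBySet.isScalarTower htors
  have : Module.Finite 𝒪[K] P := Submodule.IsLattice.finite K P
  have : Module.Finite (ResField π) (P ⧸ L.submoduleOf P) :=
    Module.Finite.of_restrictScalars_finite 𝒪[K] _ _
  have := finite_resField hπ
  have : Finite (P ⧸ L.submoduleOf P) := Module.finite_of_finite (ResField π)
  refine Set.Finite.of_finite_image
    (f := fun M => ((M.submoduleOf P).map (L.submoduleOf P).mkQ :
      Submodule 𝒪[K] (P ⧸ L.submoduleOf P)) ) (Set.toFinite _) ?_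
  have key : ∀ M : Submodule 𝒪[K] (Fin r → K), L ≤ M → M ≤ P →
      (((M.submoduleOf P).map (L.submoduleOf P).mkQ).comap (L.submoduleOf P).mkQ).map P.subtype
        = M := by
    intro M h1 h2
    rw [Submodule.comap_map_mkQ, sup_eq_right.mpr (Submodule.comap_mono h1)]
    exact (Submodule.map_comap_subtype P M).trans (inf_eq_right.mpr h2)
  intro M hM M' hM' e
  rw [← key M hM.1 hM.2, ← key M' hM'.1 hM'.2]
  simp only at e
  rw [e]

theorem OrientedEdge.finite_terminus {π : 𝒪[K]} (hπ : Irreducible π) {r : ℕ} (v : Vertex K r) :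
    {e : OrientedEdge π r | e.terminus = v}.Finite := by
  induction v using Quotient.inductionOn with
  | h L =>
    have := L.2
    have hfin := finite_between hπ L.1 ((unif hπ)⁻¹ • L.1) (by
      change unif hπ • (unif hπ)⁻¹ • L.1 ≤ L.1
      rw [smul_inv_smul])
    have hfin2 : {M : OLattice K r | L.1 ≤ M.1 ∧ M.1 ≤ (unif hπ)⁻¹ • L.1}.Finite :=
      hfin.preimage Subtype.val_injective.injOn
    refine Set.Finite.of_finite_image (f := OrientedEdge.origin)
      ((hfin2.image OLattice.cls).subset ?_) ?_
    · rintro _ ⟨⟨⟨v₀, v₁⟩, L₀, L₁, h₀, h₁, h⟩, he, rfl⟩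
      have he' : v₁ = L.cls := he
      simp only at h₀ h₁
      obtain ⟨α, hα⟩ := Quotient.exact (h₁.trans he')
      have := L₀.2
      refine ⟨⟨α • L₀.1, inferInstance⟩, ⟨?_, ?_⟩, ?_⟩
      · change L.1 ≤ α • L₀.1
        rw [← hα]
        exact units_smul_mono α h.1.le
      · change α • L₀.1 ≤ (unif hπ)⁻¹ • L.1
        have h2 : unif hπ • L₀.1 ≤ L₁.1 := h.2.le
        have := units_smul_mono (unif hπ)⁻¹ (units_smul_mono α h2)
        rwa [smul_comm α, inv_smul_smul, hα] at this
      · change _ = v₀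
        rw [← h₀]
        exact Quotient.sound ⟨α⁻¹, inv_smul_smul _ _⟩
    · intro e he e' he' h
      exact Subtype.ext (Prod.ext h ((show e.1.2 = _ from he).trans (Eq.symm he')))

theorem OrientedEdge.finite_typeTerminus {π : 𝒪[K]} (hπ : Irreducible π) {r : ℕ} (s : ℕ)
    (v : Vertex K r) : (OrientedEdge.typeTerminus (π := π) s v).Finite :=
  (OrientedEdge.finite_terminus hπ v).subset fun _ h => h.2

theorem OrientedEdge.finite_triangle {π : 𝒪[K]} (hπ : Irreducible π) {r : ℕ}
    (e : OrientedEdge π r) : e.triangle.Finite :=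
  (OrientedEdge.finite_terminus hπ e.terminus).subset (by
    rintro _ ⟨-, L₀, L₀', L₁, h, h', rfl, rfl, -⟩
    rfl)

end Finiteness

section Cochains

variable {K : Type*} [Field K] [ValuativeRel K]

/-- Harmonicity of an `R`-valued function on the oriented edges of the building. The sets that are
summed over are finite when `K` is a local field, so the `finsum`s are ordinary finite sums. -/
structure IsHarmonic {π : 𝒪[K]} (hπ : Irreducible π) {r : ℕ} {R : Type*} [AddCommGroup R]
    (h : OrientedEdge π r → R) : Prop where
  reverse : ∀ e, h e = -h (e.reverse hπ)
  star : ∀ (v : Vertex K r) (s : ℕ), 1 ≤ s → s < r →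
    ∑ᶠ e ∈ OrientedEdge.typeTerminus (π := π) s v, h e = 0
  triangle : ∀ e, ∑ᶠ e' ∈ OrientedEdge.triangle e, h e' = h e
  simplex : ∀ (L₀ L₁ L₂ : OLattice K r)
    (h₁ : L₁.1 < L₀.1) (h₂ : L₂.1 < L₁.1) (h₃ : π • L₀.1 < L₂.1),
    h (.mk L₀ L₁ ⟨h₁, h₃.trans h₂⟩) +
        h (.mk L₁ L₂ ⟨h₂, (Submodule.map_mono h₁.le).trans_lt h₃⟩) =
      h (.mk L₀ L₂ ⟨h₂.trans h₁, h₃⟩)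

theorem IsHarmonic.translate {π : 𝒪[K]} {hπ : Irreducible π} {r : ℕ} {R : Type*} [AddCommGroup R]
    {h : OrientedEdge π r → R} (H : IsHarmonic hπ h) (g : GL (Fin r) K) :
    IsHarmonic hπ (fun e => h (g⁻¹ • e)) where
  reverse e := H.reverse (g⁻¹ • e)
  star v s h1 h2 := by
    rw [← H.star (g⁻¹ • v) s h1 h2]
    refine finsum_mem_eq_of_bijOn (fun e => g⁻¹ • e)
      ⟨fun e he => OrientedEdge.smul_mem_typeTerminus he _, (MulAction.injective _).injOn, ?_⟩
      (fun _ _ => rfl)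
    intro e he
    have := OrientedEdge.smul_mem_typeTerminus he g
    rw [smul_inv_smul] at this
    exact ⟨g • e, this, inv_smul_smul _ _⟩
  triangle e := by
    rw [← H.triangle (g⁻¹ • e)]
    refine finsum_mem_eq_of_bijOn (fun e => g⁻¹ • e)
      ⟨fun e he => OrientedEdge.smul_mem_triangle he _, (MulAction.injective _).injOn, ?_⟩
      (fun _ _ => rfl)
    intro e' he
    have := OrientedEdge.smul_mem_triangle he g
    rw [smul_inv_smul] at this
    exact ⟨g • e', this, inv_smul_smul _ _⟩
  simplex L₀ L₁ L₂ h₁ h₂ h₃ := by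
    refine H.simplex (g⁻¹ • L₀) (g⁻¹ • L₁) (g⁻¹ • L₂) (lt_smul _ h₁) (lt_smul _ h₂) ?_
    have := lt_smul (g⁻¹)⁻¹ h₃
    rwa [map_rowMul_smul_int] at this

end Cochains

section CochainGroup

variable {K : Type*} [Field K] [ValuativeRel K] [TopologicalSpace K] [IsNonarchimedeanLocalField K]

/-- The group `Har¹(B, R)` of `R`-valued harmonic `1`-cochains on the building. -/
def harmonicCochains {π : 𝒪[K]} (hπ : Irreducible π) (r : ℕ) (R : Type*) [AddCommGroup R] :
    AddSubgroup (OrientedEdge π r → R) where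
  carrier := {h | IsHarmonic hπ h}
  add_mem' {h h'} H H' :=
    { reverse := fun e => by
        simp only [Pi.add_apply]
        rw [H.reverse e, H'.reverse e, neg_add]
      star := fun v s h1 h2 => by
        simp only [Pi.add_apply]
        rw [finsum_mem_add_distrib (OrientedEdge.finite_typeTerminus hπ s v), H.star v s h1 h2,
          H'.star v s h1 h2, add_zero]
      triangle := fun e => by
        simp only [Pi.add_apply]
        rw [finsum_mem_add_distrib (OrientedEdge.finite_triangle hπ e), H.triangle, H'.triangle]
      simplex := fun L₀ L₁ L₂ h₁ h₂ h₃ => by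
        simp only [Pi.add_apply]
        rw [← H.simplex L₀ L₁ L₂ h₁ h₂ h₃, ← H'.simplex L₀ L₁ L₂ h₁ h₂ h₃]
        abel }
  zero_mem' :=
    { reverse := fun e => by simp
      star := fun v s h1 h2 => by simp
      triangle := fun e => by simp
      simplex := fun L₀ L₁ L₂ h₁ h₂ h₃ => by simp }
  neg_mem' {h} H :=
    { reverse := fun e => by
        simp only [Pi.neg_apply]
        rw [H.reverse e]
      star := fun v s h1 h2 => by
        simp only [Pi.neg_apply]
        rw [finsum_mem_neg_distrib _ (OrientedEdge.finite_typeTerminus hπ s v), H.star v s h1 h2,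
          neg_zero]
      triangle := fun e => by
        simp only [Pi.neg_apply]
        rw [finsum_mem_neg_distrib _ (OrientedEdge.finite_triangle hπ e), H.triangle]
      simplex := fun L₀ L₁ L₂ h₁ h₂ h₃ => by
        simp only [Pi.neg_apply]
        rw [← H.simplex L₀ L₁ L₂ h₁ h₂ h₃, neg_add] }

/-- `GL_r(K)` acts on harmonic cochains by `(g h)(e) = h(g⁻¹ e)`. -/
instance {π : 𝒪[K]} (hπ : Irreducible π) (r : ℕ) (R : Type*) [AddCommGroup R] :
    DistribMulAction (GL (Fin r) K) (harmonicCochains hπ r R) where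
  smul g h := ⟨fun e => h.1 (g⁻¹ • e), IsHarmonic.translate h.2 g⟩
  one_smul h := Subtype.ext (funext fun e => by
    change h.1 ((1 : GL (Fin r) K)⁻¹ • e) = h.1 e
    rw [inv_one, one_smul])
  mul_smul g g' h := Subtype.ext (funext fun e => by
    change h.1 ((g * g')⁻¹ • e) = h.1 (g'⁻¹ • g⁻¹ • e)
    rw [mul_inv_rev, mul_smul])
  smul_zero g := rfl
  smul_add g h h' := rfl

end CochainGroup

section Matrices

variable {K : Type*} [Field K] [ValuativeRel K]

/-- The subgroup of `GL_r(O)` of matrices whose lower left `(r - s) × s` block vanishes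
modulo `π`. -/
def parahoricInt (π : 𝒪[K]) (r s : ℕ) : Subgroup (GL (Fin r) 𝒪[K]) where
  carrier := {k | ∀ i j : Fin r, s ≤ i.val → j.val < s →
    π ∣ (k : Matrix (Fin r) (Fin r) 𝒪[K]) i j}
  one_mem' i j hi hj := by
    rw [Units.val_one, Matrix.one_apply_ne (by rintro rfl; omega)]
    exact dvd_zero _
  mul_mem' {a b} ha hb i j hi hj := by
    rw [Units.val_mul, Matrix.mul_apply]
    refine Finset.dvd_sum fun l _ => ?_
    by_cases hl : l.val < s
    · exact (ha i l hi hl).mul_right _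
    · exact (hb l j (not_lt.mp hl) hj).mul_left _
  inv_mem' {a} ha i j hi hj := by
    let q : 𝒪[K] →+* 𝒪[K] ⧸ Ideal.span {π} := Ideal.Quotient.mk _
    let A : GL (Fin r) (𝒪[K] ⧸ Ideal.span {π}) := Matrix.GeneralLinearGroup.map q a
    let b : Fin r → ℕ := fun i => if i.val < s then 0 else 1
    have hA : Matrix.BlockTriangular (A : Matrix _ _ (𝒪[K] ⧸ Ideal.span {π})) b := by
      intro i j hij
      have h1 : j.val < s := by by_contra h; simp [b, h] at hij; split_ifs at hij <;> omega
      have h2 : s ≤ i.val := by by_contra h; simp [b, not_le.mp h] at hij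
      exact Ideal.Quotient.eq_zero_iff_dvd _ _ |>.mpr (ha i j h2 h1)
    letI : Invertible (A : Matrix (Fin r) (Fin r) (𝒪[K] ⧸ Ideal.span {π})) := A.invertible
    have hB := Matrix.blockTriangular_inv_of_blockTriangular hA
    have := @hB i j (by simp [b, hj, not_lt.mpr hi])
    rw [← Matrix.coe_units_inv, ← map_inv] at this
    exact Ideal.Quotient.eq_zero_iff_dvd _ _ |>.mp this

/-- The parahoric subgroup `I^s` of `GL_r(O)`, seen inside `GL_r(K)`. -/
def parahoric (π : 𝒪[K]) (r s : ℕ) : Subgroup (GL (Fin r) K) :=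
  (parahoricInt π r s).map (Matrix.GeneralLinearGroup.map (algebraMap 𝒪[K] K))

/-- The subgroup `Kˣ I^s` of `GL_r(K)`, with `Kˣ` the group of scalar matrices. -/
def scalarParahoric (π : 𝒪[K]) (r s : ℕ) : Subgroup (GL (Fin r) K) :=
  (Matrix.GeneralLinearGroup.scalar (R := K) (Fin r)).range ⊔ parahoric π r s

/-- The block matrix `diag(π I_s, I_{r-s})`. -/
def diagMat (π : 𝒪[K]) (r s : ℕ) : Matrix (Fin r) (Fin r) K :=
  Matrix.diagonal fun i => if i.val < s then (π : K) else 1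

/-- The block matrix with rows `(π, u, 0)`, `(0, I_{s-1}, 0)`, `(0, 0, I_{r-s})`. -/
def unipMat (π : 𝒪[K]) (r s : ℕ) (u : Fin (s - 1) → 𝒪[K]) : Matrix (Fin r) (Fin r) K :=
  Matrix.of fun i j =>
    if i = j then (if i.val = 0 then (π : K) else 1)
    else if h : i.val = 0 ∧ 1 ≤ j.val ∧ j.val < s then (u ⟨j.val - 1, by omega⟩ : K)
    else 0

/-- The block matrix with rows `(0, I_{r-s})`, `(π I_s, 0)`, for `s ≤ r`. -/
def rotMat (π : 𝒪[K]) (r s : ℕ) : Matrix (Fin r) (Fin r) K :=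
  Matrix.of fun i j =>
    if j.val = i.val + s then 1 else if j.val + r = i.val + s then (π : K) else 0

theorem det_diagMat {π : 𝒪[K]} (hπ : Irreducible π) (r s : ℕ) : (diagMat π r s).det ≠ 0 := by
  rw [diagMat, Matrix.det_diagonal, Finset.prod_ne_zero_iff]
  intro i _
  split_ifs
  · exact uniformizer_ne_zero hπ
  · exact one_ne_zero

theorem det_unipMat {π : 𝒪[K]} (hπ : Irreducible π) (r s : ℕ) (u : Fin (s - 1) → 𝒪[K]) :
    (unipMat π r s u).det ≠ 0 := by
  have h : (unipMat π r s u).BlockTriangular id := by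
    intro i j hij
    have hij' : j.val < i.val := hij
    have h1 : i ≠ j := by rintro rfl; omega
    have h2 : i.val ≠ 0 := by omega
    simp [unipMat, h1, h2]
  rw [Matrix.det_of_isUpperTriangular h, Finset.prod_ne_zero_iff]
  intro i _
  simp only [unipMat, Matrix.of_apply, if_true]
  split_ifs
  · exact uniformizer_ne_zero hπ
  · exact one_ne_zero

theorem det_rotMat {π : 𝒪[K]} (hπ : Irreducible π) {r s : ℕ} (hs : s ≤ r) :
    (rotMat π r s).det ≠ 0 := by
  have hπ0 := uniformizer_ne_zero hπ
  refine (Matrix.isUnit_iff_isUnit_det _).mp ?_ |>.ne_zero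
  refine IsUnit.of_mul_eq_one_right (Matrix.of fun j i : Fin r =>
    if j.val = i.val + s then (1 : K) else if j.val + r = i.val + s then (π : K)⁻¹ else 0) ?_
  ext a b
  rw [Matrix.mul_apply]
  by_cases ha : s ≤ a.val
  · rw [Finset.sum_eq_single ⟨a.val - s, by omega⟩]
    · by_cases hab : a = b
      · subst hab
        simp [rotMat, ha]
      · have : a.val ≠ b.val := fun h => hab (Fin.ext h)
        have h1 : ¬ b.val = a.val - s + s := by omega
        have h2 : ¬ b.val + r = a.val - s + s := by omega
        simp [rotMat, h1, h2, hab]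
    · intro i _ hi
      have : i.val ≠ a.val - s := fun h => hi (Fin.ext h)
      have h1 : ¬ a.val = i.val + s := by omega
      have h2 : ¬ a.val + r = i.val + s := by omega
      simp [h1, h2]
    · simp
  · rw [Finset.sum_eq_single ⟨a.val + r - s, by omega⟩]
    · by_cases hab : a = b
      · subst hab
        have h1 : ¬ a.val = a.val + r - s + s := by omega
        have h2 : a.val + r = a.val + r - s + s := by omega
        simp only [rotMat, Matrix.of_apply, if_neg h1, if_pos h2, Matrix.one_apply_eq]
        exact inv_mul_cancel₀ hπ0
      · have : a.val ≠ b.val := fun h => hab (Fin.ext h)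
        have h1 : ¬ b.val = a.val + r - s + s := by omega
        have h2 : ¬ b.val + r = a.val + r - s + s := by omega
        simp [rotMat, h1, h2, hab]
    · intro i _ hi
      have : i.val ≠ a.val + r - s := fun h => hi (Fin.ext h)
      have h1 : ¬ a.val = i.val + s := by omega
      have h2 : ¬ a.val + r = i.val + s := by omega
      simp [h1, h2]
    · simp

/-- `diag(π I_s, I_{r-s})` as an element of `GL_r(K)`. -/
def diagGL {π : 𝒪[K]} (hπ : Irreducible π) (r s : ℕ) : GL (Fin r) K :=
  .mkOfDetNeZero (diagMat π r s) (det_diagMat hπ r s)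

/-- `unipMat` as an element of `GL_r(K)`. -/
def unipGL {π : 𝒪[K]} (hπ : Irreducible π) (r s : ℕ) (u : Fin (s - 1) → 𝒪[K]) :
    GL (Fin r) K :=
  .mkOfDetNeZero (unipMat π r s u) (det_unipMat hπ r s u)

/-- `rotMat` as an element of `GL_r(K)`. -/
def rotGL {π : 𝒪[K]} (hπ : Irreducible π) {r s : ℕ} (hs : s ≤ r) : GL (Fin r) K :=
  .mkOfDetNeZero (rotMat π r s) (det_rotMat hπ hs)

/-- The standard lattice `Λ₀ = O ^ r`. -/
def stdLattice (K : Type*) [Field K] [ValuativeRel K] (r : ℕ) : OLattice K r :=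
  ⟨{ carrier := {x | ∀ i, x i ∈ 𝒪[K]}
     add_mem' := fun hx hy i => add_mem (hx i) (hy i)
     zero_mem' := fun _ => zero_mem _
     smul_mem' := fun c _ hx i => mul_mem c.2 (hx i) }, by
    refine ⟨?_, ?_⟩
    · let φ : (Fin r → 𝒪[K]) →ₗ[𝒪[K]] (Fin r → K) :=
        { toFun := fun y i => (y i : K)
          map_add' := fun _ _ => rfl
          map_smul' := fun _ _ => rfl }
      convert (Module.Finite.fg_top (R := 𝒪[K]) (M := Fin r → 𝒪[K])).map φ
      ext x
      simp only [Submodule.map_top]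
      constructor
      · intro hx
        exact ⟨fun i => ⟨x i, hx i⟩, rfl⟩
      · rintro ⟨y, rfl⟩ i
        exact (y i).2
    · rw [eq_top_iff, ← (Pi.basisFun K (Fin r)).span_eq]
      refine Submodule.span_mono ?_
      rintro _ ⟨j, rfl⟩ i
      rw [Pi.basisFun_apply, Pi.single_apply]
      split_ifs
      · exact one_mem _
      · exact zero_mem _⟩

theorem mem_stdLattice {r : ℕ} {x : Fin r → K} :
    x ∈ (stdLattice K r).1 ↔ ∀ i, x i ∈ 𝒪[K] := Iff.rfl

theorem rowMul_diagGL {π : 𝒪[K]} (hπ : Irreducible π) (r s : ℕ) (x : Fin r → K) (i : Fin r) :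
    rowMul (diagGL hπ r s) x i = x i * (if i.val < s then (π : K) else 1) := by
  change (x ᵥ* diagMat π r s) i = _
  rw [diagMat, Matrix.vecMul_diagonal]

theorem inv_unif_not_mem {π : 𝒪[K]} (hπ : Irreducible π) (a : K) (ha : a ∈ 𝒪[K])
    (h : a * (π : K) = 1) : False :=
  hπ.not_isUnit (IsUnit.of_mul_eq_one_right ⟨a, ha⟩ (Subtype.ext h))

theorem adj_std {π : 𝒪[K]} (hπ : Irreducible π) {r s : ℕ} (h1 : 1 ≤ s) (h2 : s < r) :
    Adj π (stdLattice K r) ((stdLattice K r).mulRight (diagGL hπ r s)) := by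
  constructor
  · refine lt_of_le_not_ge ?_ fun h => ?_
    · rintro _ ⟨y, hy, rfl⟩ i
      rw [rowMul_diagGL]
      refine mul_mem (hy i) ?_
      split_ifs
      · exact π.2
      · exact one_mem _
    · obtain ⟨y, hy, hyx⟩ := h (show (fun _ => (1 : K)) ∈ (stdLattice K r).1 from
        fun i => one_mem _)
      have := congrFun hyx ⟨0, by omega⟩
      rw [rowMul_diagGL, if_pos (show 0 < s from h1)] at this
      exact inv_unif_not_mem hπ _ (hy _) this
  · refine lt_of_le_not_ge ?_ fun h => ?_
    · rintro _ ⟨y, hy, rfl⟩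
      refine ⟨fun i => if i.val < s then y i else (π : K) * y i, fun i => ?_, ?_⟩
      · simp only
        split_ifs
        · exact hy i
        · exact mul_mem π.2 (hy i)
      · funext i
        rw [rowMul_diagGL]
        change _ = (π : K) * y i
        split_ifs <;> ring
    · obtain ⟨y, hy, hyx⟩ := h ⟨fun _ => 1, fun i => one_mem _, rfl⟩
      have := congrFun hyx ⟨s, h2⟩
      rw [rowMul_diagGL, if_neg (lt_irrefl _)] at this
      have h3 : (π : K) * y ⟨s, h2⟩ = 1 * 1 := this
      rw [mul_comm, one_mul] at h3
      exact inv_unif_not_mem hπ _ (hy _) h3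

/-- The standard edge `e^s = ([Λ₀], [Λ₀ diag(π I_s, I_{r-s})])` of type `s`. -/
def stdEdge {π : 𝒪[K]} (hπ : Irreducible π) {r s : ℕ} (h1 : 1 ≤ s) (h2 : s < r) :
    OrientedEdge π r :=
  .mk (stdLattice K r) ((stdLattice K r).mulRight (diagGL hπ r s)) (adj_std hπ h1 h2)

end Matrices

section GroupFunctions

variable {K : Type*} [Field K] [ValuativeRel K] [TopologicalSpace K] [IsNonarchimedeanLocalField K]

/-- The two harmonicity relations for an `R`-valued function on `GL_r(K) / Kˣ I^1`. Here `σ` picks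
a representative in `O` of each element of `F_q = O / (π)`; the `finsum` runs over the finite set
`F_q ^ (s - 1)`. -/
structure IsHarmonicGL {π : 𝒪[K]} (hπ : Irreducible π) (σ : ResField π → 𝒪[K]) {r : ℕ}
    {R : Type*} [AddCommGroup R] (f : GL (Fin r) K ⧸ scalarParahoric π r 1 → R) : Prop where
  unip : ∀ (g : GL (Fin r) K) (s : ℕ), 1 ≤ s → s ≤ r →
    ∑ᶠ u : Fin (s - 1) → ResField π, f (QuotientGroup.mk (g * unipGL hπ r s (fun i => σ (u i)))) =
      f (QuotientGroup.mk (g * diagGL hπ r s))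
  rot : ∀ g : GL (Fin r) K,
    ∑ s : Finset.Icc 1 r,
      f (QuotientGroup.mk (g * rotGL hπ (Finset.mem_Icc.mp s.2).2)) = 0

/-- The group of `R`-valued functions on `GL_r(K) / Kˣ I^1` satisfying the two relations. -/
def harmonicFunctions {π : 𝒪[K]} (hπ : Irreducible π) (σ : ResField π → 𝒪[K]) (r : ℕ) (R : Type*)
    [AddCommGroup R] : AddSubgroup (GL (Fin r) K ⧸ scalarParahoric π r 1 → R) where
  carrier := {f | IsHarmonicGL hπ σ f}
  add_mem' {f f'} H H' :=
    { unip := fun g s h1 h2 => by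
        have := finite_resField hπ
        simp only [Pi.add_apply]
        rw [finsum_add_distrib (Set.toFinite _) (Set.toFinite _), H.unip g s h1 h2,
          H'.unip g s h1 h2]
      rot := fun g => by
        simp only [Pi.add_apply]
        rw [Finset.sum_add_distrib, H.rot, H'.rot, add_zero] }
  zero_mem' :=
    { unip := fun g s h1 h2 => by simp
      rot := fun g => by simp }
  neg_mem' {f} H :=
    { unip := fun g s h1 h2 => by
        simp only [Pi.neg_apply]
        rw [finsum_neg_distrib, H.unip g s h1 h2]
      rot := fun g => by
        simp only [Pi.neg_apply]
        rw [Finset.sum_neg_distrib, H.rot, neg_zero] }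

/-- `GL_r(K)` acts on these functions by left translation, `(γ f)(x) = f(γ⁻¹ x)`. -/
instance {π : 𝒪[K]} (hπ : Irreducible π) (σ : ResField π → 𝒪[K]) (r : ℕ) (R : Type*)
    [AddCommGroup R] : DistribMulAction (GL (Fin r) K) (harmonicFunctions hπ σ r R) where
  smul γ f := ⟨fun x => f.1 (γ⁻¹ • x),
    { unip := fun g s h1 h2 => by
        have := f.2.unip (γ⁻¹ * g) s h1 h2
        simp only [mul_assoc] at this
        exact this
      rot := fun g => by
        have := f.2.rot (γ⁻¹ * g)
        simp only [mul_assoc] at this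
        exact this }⟩
  one_smul f := Subtype.ext (funext fun x => by
    change f.1 ((1 : GL (Fin r) K)⁻¹ • x) = f.1 x
    rw [inv_one, one_smul])
  mul_smul g g' f := Subtype.ext (funext fun x => by
    change f.1 ((g * g')⁻¹ • x) = f.1 (g'⁻¹ • g⁻¹ • x)
    rw [mul_inv_rev, mul_smul])
  smul_zero g := rfl
  smul_add g f f' := rfl

end GroupFunctions

end BruhatTits

end

/-! An oriented edge is a pair of lattices `L ⊊ W ⊊ π⁻¹L` up to a common scalar. Admitting also `W =
L` and `W = π⁻¹L`, with value `0`, turns the harmonic conditions into statements about a function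
`Q(W, L)` (`IsPairHarmonic`): homothety invariance; additivity along `L ≤ W' ≤ W`, which unites the
simplex relation and reversal; vanishing of `Q(π⁻¹L, L)`; and `Q(W, L) = ∑ Q(ℓ, L)` over the lines
`ℓ` of `W/L`, which unites the triangle relation and the vertex condition for `s = 1`. The vertex
conditions for other `s` follow by double counting (`star_of_star_one`).

Edges of type 1 are the covers `L ⋖ ℓ`. They form one `GL_r(K)`-orbit, and an element fixing both
lattices of `e¹` lies in `I^1`. A function `f` on `GL_r(K)/KˣI^1` is therefore a homothety-invariant
function of covers. The line-sum condition forces its extension to all pairs, namely `lineSum`,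
which gives injectivity. Surjectivity requires this extension to be pair-harmonic, and the two
relations on `f` express exactly what is missing.

Since `g • L = L g⁻¹`, the matrix `diag(π I_s, I)` enlarges `Λ₀` to `W = Λ₀ + π⁻¹⟨e₁,…,e_s⟩` and
sends `Λ₁` to `W' = Λ₀ + π⁻¹⟨e₂,…,e_s⟩`. The unipotent matrices send `e¹` to the edges `(ℓ, Λ₀)`,
with `ℓ` running once over the lines of `W/Λ₀` outside `W'/Λ₀` (`bijOn_unipGL`). The first relation
thus says that the line sums of `W` and `W'` differ by `Q(W, W')`, that is, additivity for a cover
`W' ⋖ W`. Every chain `L ≤ W' ⋖ W ≤ π⁻¹L` is a translate of such a standard one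
(`exists_smul_flag_eq`), and induction on `W` gives general additivity (`lineSum_eq_add`). The
matrices of the second relation send `e¹` to the steps of a full flag from `Λ₀` to `π⁻¹Λ₀`, so by
telescoping that relation is the vanishing of `Q(π⁻¹L, L)`. -/

noncomputable section

namespace BruhatTits

/-! ### Lattices as an ordered set, homotheties, and representatives of edges -/

section Order

variable {K : Type*} [Field K] [ValuativeRel K] {r : ℕ}

instance : PartialOrder (OLattice K r) :=
  inferInstanceAs (PartialOrder {L : Submodule 𝒪[K] (Fin r → K) // L.IsLattice K})

/-- Scaling of lattices by `Kˣ`. -/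
instance : MulAction Kˣ (OLattice K r) where
  smul α L := ⟨α • L.1, haveI := L.2; inferInstance⟩
  one_smul _ := Subtype.ext (one_smul _ _)
  mul_smul _ _ _ := Subtype.ext (mul_smul _ _ _)

instance : SMulCommClass (GL (Fin r) K) Kˣ (OLattice K r) where
  smul_comm g α L := Subtype.ext (map_rowMul_smul g⁻¹ α L.1)

instance : SMulCommClass Kˣ (GL (Fin r) K) (OLattice K r) := SMulCommClass.symm _ _ _

theorem cls_eq_iff {L M : OLattice K r} : L.cls = M.cls ↔ ∃ α : Kˣ, α • L = M := by
  refine ⟨fun h => ?_, ?_⟩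
  · obtain ⟨α, h⟩ := Quotient.exact h
    exact ⟨α, Subtype.ext h⟩
  · rintro ⟨α, rfl⟩
    exact Quotient.sound ⟨α, rfl⟩

@[simp] theorem cls_units_smul (α : Kˣ) (L : OLattice K r) : (α • L).cls = L.cls :=
  cls_eq_iff.mpr ⟨α⁻¹, inv_smul_smul _ _⟩

theorem OLattice.mem_smul_iff (g : GL (Fin r) K) (L : OLattice K r) (x : Fin r → K) :
    x ∈ (g • L).1 ↔ rowMul g x ∈ L.1 := by
  rw [OLattice.smul_val, Submodule.mem_map]
  constructor
  · rintro ⟨y, hy, rfl⟩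
    rwa [rowMul_rowMul_inv]
  · exact fun h => ⟨_, h, rowMul_inv_rowMul g x⟩

theorem OLattice.mem_units_smul_iff (α : Kˣ) (L : OLattice K r) (x : Fin r → K) :
    x ∈ (α • L).1 ↔ (α⁻¹ : K) • x ∈ L.1 := by
  constructor
  · rintro ⟨y, hy, rfl⟩
    change (α⁻¹ : K) • (α : K) • y ∈ L.1
    rw [smul_smul, inv_mul_cancel₀ α.ne_zero, one_smul]
    exact hy
  · intro h
    refine ⟨_, h, ?_⟩
    change (α : K) • (α⁻¹ : K) • x = x
    rw [smul_smul, mul_inv_cancel₀ α.ne_zero, one_smul]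

theorem OLattice.ext_mem {L M : OLattice K r} (h : ∀ x, x ∈ L.1 ↔ x ∈ M.1) : L = M :=
  Subtype.ext (Submodule.ext h)

@[simp] theorem OLattice.smul_le_smul_iff (g : GL (Fin r) K) {L M : OLattice K r} :
    g • L ≤ g • M ↔ L ≤ M := by
  refine ⟨fun h => ?_, fun h => Submodule.map_mono h⟩
  have := Submodule.map_mono (f := rowMul g⁻¹⁻¹) h
  change (g⁻¹ • g • L).1 ≤ (g⁻¹ • g • M).1 at this
  rwa [inv_smul_smul, inv_smul_smul] at this

@[simp] theorem OLattice.units_smul_le_smul_iff (α : Kˣ) {L M : OLattice K r} :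
    α • L ≤ α • M ↔ L ≤ M := by
  refine ⟨fun h => ?_, fun h => units_smul_mono α h⟩
  have : (α⁻¹ • α • L).1 ≤ (α⁻¹ • α • M).1 := units_smul_mono α⁻¹ h
  rwa [inv_smul_smul, inv_smul_smul] at this

/-- The order automorphism of the lattices given by an element of `GL_r(K)`. -/
def OLattice.smulOrderIso (g : GL (Fin r) K) : OLattice K r ≃o OLattice K r where
  toEquiv := MulAction.toPerm g
  map_rel_iff' := OLattice.smul_le_smul_iff g

/-- The order automorphism of the lattices given by a scalar. -/
def OLattice.unitsSmulOrderIso (α : Kˣ) : OLattice K r ≃o OLattice K r where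
  toEquiv := MulAction.toPerm α
  map_rel_iff' := OLattice.units_smul_le_smul_iff α

@[simp] theorem OLattice.units_smul_lt_smul_iff (α : Kˣ) {L M : OLattice K r} :
    α • L < α • M ↔ L < M :=
  (unitsSmulOrderIso α).lt_iff_lt

@[simp] theorem OLattice.smul_covBy_smul_iff (g : GL (Fin r) K) {L M : OLattice K r} :
    g • L ⋖ g • M ↔ L ⋖ M :=
  apply_covBy_apply_iff (smulOrderIso g)

@[simp] theorem OLattice.units_smul_covBy_smul_iff (α : Kˣ) {L M : OLattice K r} :
    α • L ⋖ α • M ↔ L ⋖ M :=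
  apply_covBy_apply_iff (unitsSmulOrderIso α)

variable {π : 𝒪[K]}

theorem unif_smul_le (hπ : Irreducible π) (L : OLattice K r) : unif hπ • L ≤ L := by
  rintro _ ⟨y, hy, rfl⟩
  exact L.1.smul_mem π hy

theorem le_inv_unif_smul (hπ : Irreducible π) (L : OLattice K r) : L ≤ (unif hπ)⁻¹ • L := by
  have := unif_smul_le hπ ((unif hπ)⁻¹ • L)
  rwa [smul_inv_smul] at this

theorem unif_smul_le_iff (hπ : Irreducible π) {L M : OLattice K r} :
    unif hπ • L ≤ M ↔ L ≤ (unif hπ)⁻¹ • M := by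
  rw [← OLattice.units_smul_le_smul_iff (unif hπ) (M := (unif hπ)⁻¹ • M), smul_inv_smul]

theorem unif_smul_lt_iff (hπ : Irreducible π) {L M : OLattice K r} :
    unif hπ • L < M ↔ L < (unif hπ)⁻¹ • M := by
  rw [← OLattice.units_smul_lt_smul_iff (unif hπ) (M := (unif hπ)⁻¹ • M), smul_inv_smul]

theorem adj_iff (hπ : Irreducible π) {L₀ L₁ : OLattice K r} :
    Adj π L₀ L₁ ↔ L₁ < L₀ ∧ L₀ < (unif hπ)⁻¹ • L₁ := by
  rw [← unif_smul_lt_iff hπ]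
  rfl

theorem adj_units_smul_iff (hπ : Irreducible π) (α : Kˣ) {L₀ L₁ : OLattice K r} :
    Adj π (α • L₀) (α • L₁) ↔ Adj π L₀ L₁ := by
  rw [adj_iff hπ, adj_iff hπ, smul_comm _ α L₁]
  simp

theorem OrientedEdge.mk_units_smul (α : Kˣ) {L₀ L₁ : OLattice K r} (h : Adj π (α • L₀) (α • L₁))
    (h' : Adj π L₀ L₁) : OrientedEdge.mk (α • L₀) (α • L₁) h = .mk L₀ L₁ h' :=
  Subtype.ext (Prod.ext (cls_units_smul _ _) (cls_units_smul _ _))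

theorem units_smul_eq_self {u : Kˣ} (hu : (u : K) ∈ 𝒪[K]) (hu' : ((u⁻¹ : Kˣ) : K) ∈ 𝒪[K])
    (L : OLattice K r) : u • L = L := by
  have key : ∀ v : Kˣ, (v : K) ∈ 𝒪[K] → v • L ≤ L := by
    rintro v hv _ ⟨y, hy, rfl⟩
    exact L.1.smul_mem ⟨v, hv⟩ hy
  refine le_antisymm (key u hu) ?_
  have := key u⁻¹ hu'
  rwa [← OLattice.units_smul_le_smul_iff u, smul_inv_smul] at this

/-- The three cases are valuation zero, valuation at least one and valuation at most minus one. -/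
theorem units_trichotomy (hπ : Irreducible π) [IsDiscreteValuationRing 𝒪[K]] (α : Kˣ) :
    ((α : K) ∈ 𝒪[K] ∧ ((α⁻¹ : Kˣ) : K) ∈ 𝒪[K]) ∨ (α : K) / (π : K) ∈ 𝒪[K] ∨
      ((α⁻¹ : Kˣ) : K) / (π : K) ∈ 𝒪[K] := by
  have hπ0 := uniformizer_ne_zero hπ
  have key : ∀ β : Kˣ, (β : K) ∈ 𝒪[K] →
      ((β⁻¹ : Kˣ) : K) ∈ 𝒪[K] ∨ (β : K) / (π : K) ∈ 𝒪[K] := by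
    intro β hβ
    by_cases hu : IsUnit (⟨β, hβ⟩ : 𝒪[K])
    · left
      obtain ⟨c, hc⟩ := isUnit_iff_exists_inv.mp hu
      have : (β : K) * (c : K) = 1 := congrArg Subtype.val hc
      rw [Units.val_inv_eq_inv_val, ← eq_inv_of_mul_eq_one_right this]
      exact c.2
    · right
      have hm : (⟨β, hβ⟩ : 𝒪[K]) ∈ IsLocalRing.maximalIdeal 𝒪[K] := hu
      rw [hπ.maximalIdeal_eq, Ideal.mem_span_singleton] at hm
      obtain ⟨c, hc⟩ := hm
      have : (β : K) = π * c := congrArg Subtype.val hc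
      rw [this, mul_div_cancel_left₀ _ hπ0]
      exact c.2
  by_cases h : (α : K) ∈ 𝒪[K]
  · rcases key α h with h' | h'
    · exact Or.inl ⟨h, h'⟩
    · exact Or.inr (Or.inl h')
  · have h2 : ((α⁻¹ : Kˣ) : K) ∈ 𝒪[K] := by
      rw [Units.val_inv_eq_inv_val]
      exact ((ValuativeRel.valuation K).mem_integer_iff _).mpr (by
        rw [map_inv₀]
        refine inv_le_one_of_one_le₀ (le_of_lt ?_)
        exact lt_of_not_ge fun h' => h (((ValuativeRel.valuation K).mem_integer_iff _).mpr h'))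
    rcases key α⁻¹ h2 with h' | h'
    · rw [inv_inv] at h'; exact absurd h' h
    · exact Or.inr (Or.inr h')

theorem smul_le_unif_smul (hπ : Irreducible π) {α : Kˣ} (h : (α : K) / (π : K) ∈ 𝒪[K])
    (L : OLattice K r) :
    α • L ≤ unif hπ • L := by
  rintro _ ⟨y, hy, rfl⟩
  refine ⟨_, L.1.smul_mem ⟨_, h⟩ hy, ?_⟩
  change (π : K) • ((α : K) / π) • y = (α : K) • y
  rw [smul_smul, mul_div_cancel₀ _ (uniformizer_ne_zero hπ)]

variable [IsDiscreteValuationRing 𝒪[K]]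

/-- A scalar of positive valuation would give `α L₁ ≤ π L₁ < π L₀`, against `π L₀ < α L₁`. Negative
valuation is the same situation with `L₁` and `α L₁` exchanged. -/
theorem units_of_smul_between (hπ : Irreducible π) {α : Kˣ} {L₀ L₁ : OLattice K r} (h : Adj π L₀ L₁)
    (h' : Adj π L₀ (α • L₁)) : (α : K) ∈ 𝒪[K] ∧ ((α⁻¹ : Kˣ) : K) ∈ 𝒪[K] := by
  have key : ∀ {β : Kˣ} {M : OLattice K r}, Adj π L₀ M → Adj π L₀ (β • M) →
      (β : K) / (π : K) ∉ 𝒪[K] := by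
    intro β M hM hM' hβ
    have h1 : β • M < unif hπ • L₀ := (smul_le_unif_smul hπ hβ M).trans_lt
      ((OLattice.units_smul_lt_smul_iff _).mpr hM.1)
    exact lt_asymm h1 hM'.2
  rcases units_trichotomy hπ α with h1 | h1 | h1
  · exact h1
  · exact absurd h1 (key h h')
  · exact absurd h1 (key (M := α • L₁) h' (by rwa [inv_smul_smul]))

/-- The two vertices provide two unrelated scalars. Their ratio keeps `L₁` strictly between `π L₀`
and `L₀`, so it is a unit of `O`, fixes every lattice, and one scalar serves for both ends. -/
theorem OrientedEdge.mk_eq_mk_iff (hπ : Irreducible π) {L₀ L₁ M₀ M₁ : OLattice K r}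
    {h : Adj π L₀ L₁}
    {h' : Adj π M₀ M₁} :
    OrientedEdge.mk L₀ L₁ h = .mk M₀ M₁ h' ↔ ∃ α : Kˣ, α • L₀ = M₀ ∧ α • L₁ = M₁ := by
  constructor
  · intro e
    obtain ⟨α, hα⟩ := cls_eq_iff.mp (congrArg (fun e => e.1.1) e : L₀.cls = M₀.cls)
    obtain ⟨β, hβ⟩ := cls_eq_iff.mp (congrArg (fun e => e.1.2) e : L₁.cls = M₁.cls)
    refine ⟨α, hα, ?_⟩
    subst hα hβ
    have h2 : Adj π L₀ ((α⁻¹ * β) • L₁) := by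
      rw [← adj_units_smul_iff hπ α, mul_smul, smul_inv_smul]
      exact h'
    obtain ⟨h3, h4⟩ := units_of_smul_between hπ h h2
    have := units_smul_eq_self h3 h4 L₁
    rwa [mul_smul, inv_smul_eq_iff, eq_comm] at this
  · rintro ⟨α, rfl, rfl⟩
    exact (mk_units_smul α _ _).symm

end Order

/-- A subspace and a hyperplane in it are spanned by parts of one basis of the ambient space. -/
theorem exists_basis_flag {k V : Type*} [Field k] [AddCommGroup V] [Module k V]
    [Module.Finite k V] {r : ℕ} (hr : Module.finrank k V = r) (A : Submodule k V) {y : V}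
    (hy : y ∉ A) :
    ∃ (b : Module.Basis (Fin r) k V) (s : ℕ), 1 ≤ s ∧ s ≤ r ∧
      Submodule.span k (b '' {i | i.val < s}) = A ⊔ Submodule.span k {y} ∧
      Submodule.span k (b '' {i | 0 < i.val ∧ i.val < s}) = A := by
  obtain ⟨C, hC⟩ := Submodule.exists_isCompl (A ⊔ Submodule.span k {y})
  have hdim := Submodule.finrank_add_eq_of_isCompl hC
  rw [Submodule.finrank_sup_span_singleton hy, hr] at hdim
  subst hdim
  let bA := Module.finBasis k A
  let bC := Module.finBasis k C
  -- The extra vector `y` goes in position 0, so that dropping the first coordinate leaves `A`, as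
  -- for `Λ₁` inside `Λ₀`.
  let u : Fin (Module.finrank k A + 1) → V := Fin.cons y fun i => (bA i : V)
  let w : Fin (Module.finrank k A + 1 + Module.finrank k C) → V :=
    Fin.append u fun i => (bC i : V)
  have spanA : Submodule.span k (Set.range fun i => (bA i : V)) = A := by
    have := congrArg (Submodule.map A.subtype) bA.span_eq
    rwa [Submodule.map_span, ← Set.range_comp, Submodule.map_top, Submodule.range_subtype] at this
  have spanC : Submodule.span k (Set.range fun i => (bC i : V)) = C := by
    have := congrArg (Submodule.map C.subtype) bC.span_eq
    rwa [Submodule.map_span, ← Set.range_comp, Submodule.map_top, Submodule.range_subtype] at this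
  have spanB : Submodule.span k (Set.range u) = A ⊔ Submodule.span k {y} := by
    rw [Fin.range_cons, Submodule.span_insert, spanA, sup_comm]
  have im1 : w '' {i | i.val < Module.finrank k A + 1} = Set.range u := by
    have : {i : Fin (Module.finrank k A + 1 + Module.finrank k C) |
        i.val < Module.finrank k A + 1} = Set.range (Fin.castAdd _) := by
      ext i
      exact ⟨fun h => ⟨⟨i, h⟩, rfl⟩, by rintro ⟨j, rfl⟩; exact j.2⟩
    rw [this, ← Set.range_comp]
    congr 1
    ext i
    exact Fin.append_left _ _ i
  have im2 : w '' {i | 0 < i.val ∧ i.val < Module.finrank k A + 1} =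
      Set.range fun i => (bA i : V) := by
    have : {i : Fin (Module.finrank k A + 1 + Module.finrank k C) |
        0 < i.val ∧ i.val < Module.finrank k A + 1} =
        Set.range (Fin.castAdd (Module.finrank k C) ∘ Fin.succ) := by
      ext i
      constructor
      · rintro ⟨h0, h⟩
        exact ⟨⟨i.val - 1, by omega⟩, Fin.ext (by simp; omega)⟩
      · rintro ⟨j, rfl⟩
        exact ⟨Nat.succ_pos _, Nat.succ_lt_succ j.2⟩
    rw [this, ← Set.range_comp]
    congr 1
    ext i
    simp [w, u]
  have htop : ⊤ ≤ Submodule.span k (Set.range w) := by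
    rw [← hC.sup_eq_top]
    refine sup_le (spanB.symm.le.trans (Submodule.span_mono ?_))
      (spanC.symm.le.trans (Submodule.span_mono ?_))
    · rintro _ ⟨i, rfl⟩
      exact ⟨Fin.castAdd _ i, Fin.append_left _ _ i⟩
    · rintro _ ⟨i, rfl⟩
      exact ⟨Fin.natAdd _ i, Fin.append_right _ _ i⟩
  refine ⟨basisOfTopLeSpanOfCardEqFinrank w htop (by simp [hr]), _, Nat.succ_pos _,
    Nat.le_add_right _ _, ?_, ?_⟩
  · rw [coe_basisOfTopLeSpanOfCardEqFinrank, Nat.succ_eq_add_one, im1, spanB]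
  · rw [coe_basisOfTopLeSpanOfCardEqFinrank, Nat.succ_eq_add_one, im2, spanA]

/-! ### Standard lattices in coordinates and transitivity on lattices -/

section Lattices

variable {K : Type*} [Field K] [ValuativeRel K] {r : ℕ} {π : 𝒪[K]}

theorem mem_smul_stdLattice (g : GL (Fin r) K) (x : Fin r → K) :
    x ∈ (g • stdLattice K r).1 ↔ ∀ i, rowMul g x i ∈ 𝒪[K] :=
  OLattice.mem_smul_iff _ _ _

theorem mem_diagGL_smul (hπ : Irreducible π) (s : ℕ) (x : Fin r → K) :
    x ∈ (diagGL hπ r s • stdLattice K r).1 ↔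
      ∀ i, x i * (if i.val < s then (π : K) else 1) ∈ 𝒪[K] := by
  simp only [mem_smul_stdLattice, rowMul_diagGL]

/-- The terminus `Λ₁ = Λ₀ diag(π, 1, …, 1)` of the standard edge of type `1`. -/
def stdSublattice (hπ : Irreducible π) (r : ℕ) : OLattice K r :=
  (stdLattice K r).mulRight (diagGL hπ r 1)

theorem mem_stdSublattice (hπ : Irreducible π) (x : Fin r → K) :
    x ∈ (stdSublattice hπ r).1 ↔ ∀ i, x i * (if i.val < 1 then (π : K)⁻¹ else 1) ∈ 𝒪[K] := by
  have hπ0 := uniformizer_ne_zero hπ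
  constructor
  · rintro ⟨y, hy, rfl⟩ i
    rw [rowMul_diagGL]
    have := hy i
    split_ifs
    · rwa [mul_assoc, mul_inv_cancel₀ hπ0, mul_one]
    · rwa [mul_one, mul_one]
  · intro h
    refine ⟨_, h, funext fun i => ?_⟩
    rw [rowMul_diagGL]
    split_ifs
    · rw [mul_assoc, inv_mul_cancel₀ hπ0, mul_one]
    · rw [mul_one, mul_one]

/-- In coordinate 0 the factor `π` of the matrix cancels the `π⁻¹` in the condition for `Λ₁`; only
the coordinates strictly between `0` and `s` may have a pole. -/
theorem mem_diagGL_smul_stdSublattice (hπ : Irreducible π) {s : ℕ} (hs : 1 ≤ s) (x : Fin r → K) :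
    x ∈ (diagGL hπ r s • stdSublattice hπ r).1 ↔
      ∀ i, x i * (if 0 < i.val ∧ i.val < s then (π : K) else 1) ∈ 𝒪[K] := by
  have hπ0 := uniformizer_ne_zero hπ
  rw [OLattice.mem_smul_iff, mem_stdSublattice]
  refine forall_congr' fun i => ?_
  rw [rowMul_diagGL]
  rcases Nat.eq_zero_or_pos i.val with h0 | h0
  · simp [h0, Nat.lt_of_lt_of_le Nat.zero_lt_one hs, mul_assoc, mul_inv_cancel₀ hπ0]
  · simp [h0, Nat.one_le_iff_ne_zero.mp h0]

theorem mem_inv_unif_smul_stdLattice (hπ : Irreducible π) (x : Fin r → K) :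
    x ∈ ((unif hπ)⁻¹ • stdLattice K r).1 ↔ ∀ i, (π : K) * x i ∈ 𝒪[K] := by
  rw [OLattice.mem_units_smul_iff, Units.val_inv_eq_inv_val, inv_inv]
  rfl

/-- Matrices in `GL_r(O)` stabilize `O ^ r`. -/
theorem map_smul_stdLattice (A : GL (Fin r) 𝒪[K]) :
    Matrix.GeneralLinearGroup.map (algebraMap 𝒪[K] K) A • stdLattice K r = stdLattice K r := by
  have key : ∀ A : GL (Fin r) 𝒪[K], stdLattice K r ≤
      Matrix.GeneralLinearGroup.map (algebraMap 𝒪[K] K) A • stdLattice K r := by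
    intro A x hx
    rw [mem_smul_stdLattice]
    intro i
    change ∑ j, x j * ((A.1 j i : 𝒪[K]) : K) ∈ 𝒪[K]
    exact sum_mem fun j _ => mul_mem (hx j) (A.1 j i).2
  refine le_antisymm ?_ (key A)
  have := key A⁻¹
  rwa [map_inv, ← OLattice.smul_le_smul_iff (Matrix.GeneralLinearGroup.map (algebraMap 𝒪[K] K) A),
    smul_inv_smul] at this

/-- A lattice over a discrete valuation ring is free of rank `r`. With a basis as the rows of `A` it
equals `Λ₀ A`, which is `A⁻¹ • Λ₀`. -/
theorem exists_smul_stdLattice_eq [IsDiscreteValuationRing 𝒪[K]] (L : OLattice K r) :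
    ∃ g : GL (Fin r) K, g • stdLattice K r = L := by
  have := L.2
  let b := Module.finBasisOfFinrankEq 𝒪[K] L.1 (n := r) (by
    rw [Submodule.IsLattice.finrank_of_pi (K := K)]; simp)
  let B := b.extendOfIsLattice K
  let A : Matrix (Fin r) (Fin r) K := Matrix.of fun i => (b i : Fin r → K)
  have hA : IsUnit A := by
    rw [← Matrix.linearIndependent_rows_iff_isUnit]
    have : A.row = B := funext fun i => (b.extendOfIsLattice_apply K i).symm
    rw [this]
    exact B.linearIndependent
  refine ⟨hA.unit⁻¹, OLattice.ext_mem fun x => ?_⟩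
  rw [OLattice.smul_val, inv_inv]
  constructor
  · rintro ⟨y, hy, rfl⟩
    rw [rowMul_apply, IsUnit.unit_spec, Matrix.vecMul_eq_sum]
    exact sum_mem fun i _ => L.1.smul_mem ⟨y i, hy i⟩ (b i).2
  · intro hx
    refine ⟨fun i => b.repr ⟨x, hx⟩ i, fun i => Subtype.property _, ?_⟩
    rw [rowMul_apply, IsUnit.unit_spec, Matrix.vecMul_eq_sum]
    have := congrArg Subtype.val (b.sum_repr ⟨x, hx⟩)
    refine Eq.trans ?_ this
    simp only [AddSubmonoidClass.coe_finsetSum]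
    rfl

end Lattices

/-! ### Reduction modulo `π` and transitivity on chains of lattices -/

section Flags

variable {K : Type*} [Field K] [ValuativeRel K] {r : ℕ} {π : 𝒪[K]}

/-- If `W` covers `W'`, then `W` is generated by `W'` and any vector of `W` outside of `W'`. -/
theorem exists_sub_smul_mem_of_covBy {W' W : OLattice K r} (h : W' ⋖ W) {x₀ : Fin r → K}
    (hx₀ : x₀ ∈ W.1) (hx₀' : x₀ ∉ W'.1) {x : Fin r → K} (hx : x ∈ W.1) :
    ∃ c : 𝒪[K], x - c • x₀ ∈ W'.1 := by
  have := W'.2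
  let N : OLattice K r := ⟨W'.1 ⊔ Submodule.span 𝒪[K] {x₀},
    Submodule.IsLattice.of_le_of_isLattice_of_fg K le_sup_left
      (W'.2.fg.sup (Submodule.fg_span_singleton x₀))⟩
  have h1 : W' < N := lt_of_le_not_ge (le_sup_left : W'.1 ≤ _) fun hN =>
    hx₀' (hN (Submodule.mem_sup_right (Submodule.mem_span_singleton_self x₀)))
  have h2 : N ≤ W := sup_le h.le ((Submodule.span_singleton_le_iff_mem _ _).mpr hx₀)
  have h3 : N = W := h2.eq_of_not_lt (h.2 h1)
  rw [← h3] at hx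
  obtain ⟨y, hy, z, hz, rfl⟩ := Submodule.mem_sup.mp hx
  obtain ⟨c, rfl⟩ := Submodule.mem_span_singleton.mp hz
  exact ⟨c, by rwa [add_sub_cancel_right]⟩

theorem mk_span_eq_zero_iff (hπ : Irreducible π) (a : 𝒪[K]) :
    Ideal.Quotient.mk (Ideal.span {π}) a = 0 ↔ (a : K) / π ∈ 𝒪[K] := by
  have hπ0 := uniformizer_ne_zero hπ
  rw [Ideal.Quotient.eq_zero_iff_mem, Ideal.mem_span_singleton]
  constructor
  · rintro ⟨c, rfl⟩
    change (π : K) * (c : K) / π ∈ 𝒪[K]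
    rw [mul_div_cancel_left₀ _ hπ0]
    exact c.2
  · intro h
    exact ⟨⟨_, h⟩, Subtype.ext (mul_div_cancel₀ (a : K) hπ0).symm⟩

/-- The image in `F_q ^ r` of `π M ∩ O ^ r`. -/
def reduction (π : 𝒪[K]) (M : OLattice K r) : Submodule (ResField π) (Fin r → ResField π) where
  carrier := {y | ∃ x : Fin r → 𝒪[K], (fun i => Ideal.Quotient.mk (Ideal.span {π}) (x i)) = y ∧
    (fun i => (x i : K) / π) ∈ M.1}
  zero_mem' := ⟨0, rfl, by convert M.1.zero_mem using 1; ext i; simp⟩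
  add_mem' := by
    rintro _ _ ⟨x, rfl, hx⟩ ⟨y, rfl, hy⟩
    refine ⟨x + y, funext fun i => map_add _ _ _, ?_⟩
    convert M.1.add_mem hx hy using 1
    ext i
    simp [add_div]
  smul_mem' := by
    rintro c _ ⟨x, rfl, hx⟩
    obtain ⟨c, rfl⟩ := Ideal.Quotient.mk_surjective c
    refine ⟨c • x, funext fun i => map_mul _ _ _, ?_⟩
    convert M.1.smul_mem c hx using 1
    ext i
    exact mul_div_assoc _ _ _

/-- The choice of the lift is immaterial: two lifts differ by a multiple of `π`, which after
division by `π` lies in `Λ₀ ≤ M`. -/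
theorem mem_reduction_iff (hπ : Irreducible π) {M : OLattice K r} (h : stdLattice K r ≤ M)
    (x : Fin r → 𝒪[K]) : (fun i => Ideal.Quotient.mk (Ideal.span {π}) (x i)) ∈ reduction π M ↔
      (fun i => (x i : K) / π) ∈ M.1 := by
  refine ⟨?_, fun hx => ⟨x, rfl, hx⟩⟩
  rintro ⟨y, hy, hyM⟩
  have h1 : (fun i => ((x i - y i : 𝒪[K]) : K) / π) ∈ M.1 := h fun i => by
    rw [← mk_span_eq_zero_iff hπ, map_sub, sub_eq_zero]
    exact (congrFun hy i).symm
  convert M.1.add_mem h1 hyM using 1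
  ext i
  simp [sub_div]

/-- A cover reduces to a hyperplane in a subspace, the input of `exists_basis_flag`; `y` is the
class of `π x₀` for any `x₀` in `W` outside `W'`. -/
theorem reduction_eq_sup_of_covBy (hπ : Irreducible π) {W' W : OLattice K r} (h : W' ⋖ W)
    (hW' : stdLattice K r ≤ W') (hW : W ≤ (unif hπ)⁻¹ • stdLattice K r) :
    ∃ y, y ∉ reduction π W' ∧
      reduction π W = reduction π W' ⊔ Submodule.span (ResField π) {y} := by
  have hπ0 := uniformizer_ne_zero hπ
  obtain ⟨x₀, hx₀, hx₀'⟩ := SetLike.exists_of_lt (p := W'.1) (q := W.1) h.1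
  have hint := (mem_inv_unif_smul_stdLattice hπ x₀).mp (hW hx₀)
  let y₀ : Fin r → 𝒪[K] := fun i => ⟨_, hint i⟩
  have hy₀ : (fun i => (y₀ i : K) / π) = x₀ := funext fun i => mul_div_cancel_left₀ _ hπ0
  refine ⟨fun i => Ideal.Quotient.mk _ (y₀ i), ?_, ?_⟩
  · rwa [mem_reduction_iff hπ hW', hy₀]
  · refine le_antisymm ?_ (sup_le ?_ ?_)
    · rintro _ ⟨x, rfl, hx⟩
      obtain ⟨c, hc⟩ := exists_sub_smul_mem_of_covBy h hx₀ hx₀' hx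
      refine Submodule.mem_sup.mpr ⟨_, ⟨x - c • y₀, rfl, ?_⟩, _, Submodule.smul_mem _
        (Ideal.Quotient.mk _ c) (Submodule.mem_span_singleton_self _), ?_⟩
      · convert hc using 1
        ext i
        change ((x i : K) - (c : K) * (y₀ i : K)) / π = (x i : K) / π - (c : K) * x₀ i
        rw [sub_div, mul_div_assoc, ← hy₀]
      · ext i
        simp
    · rintro _ ⟨x, rfl, hx⟩
      exact ⟨x, rfl, h.le hx⟩
    · rw [Submodule.span_singleton_le_iff_mem]
      exact ⟨y₀, rfl, hy₀ ▸ hx₀⟩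

/-- Lifting a basis of `F_q ^ r` to a matrix in `GL_r(O)`. -/
theorem exists_lift_basis [IsDiscreteValuationRing 𝒪[K]] (hπ : Irreducible π)
    (b : Module.Basis (Fin r) (ResField π) (Fin r → ResField π)) :
    ∃ A : GL (Fin r) 𝒪[K], ∀ i j, Ideal.Quotient.mk (Ideal.span {π}) (A.1 i j) = b i j := by
  choose a ha using fun i j => Ideal.Quotient.mk_surjective (I := Ideal.span {π}) (b i j)
  let M : Matrix (Fin r) (Fin r) 𝒪[K] := Matrix.of a
  have hmax : (Ideal.span {π}).IsMaximal := by
    rw [← hπ.maximalIdeal_eq]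
    infer_instance
  have hdet : IsUnit (Ideal.Quotient.mk (Ideal.span {π}) M.det) := by
    have h1 := (Pi.basisFun (ResField π) (Fin r)).isUnit_det b
    rw [Module.Basis.det_apply, ← Matrix.det_transpose] at h1
    rw [RingHom.map_det]
    convert h1 using 2
    ext i j
    simp [M, ha, Module.Basis.toMatrix_apply]
  have hunit : IsUnit M.det := by
    by_contra hn
    have hm : M.det ∈ IsLocalRing.maximalIdeal 𝒪[K] := hn
    rw [hπ.maximalIdeal_eq, ← Ideal.Quotient.eq_zero_iff_mem] at hm
    rw [hm] at hdet
    exact not_isUnit_zero hdet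
  exact ⟨((Matrix.isUnit_iff_isUnit_det M).mpr hunit).unit, fun i j => ha i j⟩

/-- A lattice between `O ^ r` and `π⁻¹ O ^ r` in coordinates adapted to its reduction. -/
theorem mem_iff_of_reduction_eq (hπ : Irreducible π) {M : OLattice K r}
    (h : stdLattice K r ≤ M) (h' : M ≤ (unif hπ)⁻¹ • stdLattice K r)
    (b : Module.Basis (Fin r) (ResField π) (Fin r → ResField π)) (A : GL (Fin r) 𝒪[K])
    (hA : ∀ i j, Ideal.Quotient.mk (Ideal.span {π}) (A.1 i j) = b i j) (p : Fin r → Prop)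
    [DecidablePred p] (hM : Submodule.span (ResField π) (b '' {i | p i}) = reduction π M)
    (x : Fin r → K) : x ∈ M.1 ↔
      ∀ i, rowMul (Matrix.GeneralLinearGroup.map (algebraMap 𝒪[K] K) A)⁻¹ x i *
        (if p i then (π : K) else 1) ∈ 𝒪[K] := by
  have hπ0 := uniformizer_ne_zero hπ
  set B := Matrix.GeneralLinearGroup.map (algebraMap 𝒪[K] K) A with hB
  obtain ⟨c, rfl⟩ : ∃ c, rowMul B c = x := ⟨_, rowMul_rowMul_inv B x⟩
  rw [rowMul_inv_rowMul]
  -- When `d = π c` is integral, `d A` reduces to the combination of the `b j` with coefficients `d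
  -- j` mod `π`. It lies in the span of the selected `b i` exactly when `d i ≡ 0`, that is `c i ∈
  -- O`, at the other indices. Both sides of the equivalence force `d` to be integral, so this case
  -- suffices.
  have key : (∀ i, (π : K) * c i ∈ 𝒪[K]) → (rowMul B c ∈ M.1 ↔
      ∀ i, c i * (if p i then (π : K) else 1) ∈ 𝒪[K]) := by
    intro hc
    let d : Fin r → 𝒪[K] := fun i => ⟨_, hc i⟩
    have h1 : (fun i => ((d ᵥ* A.1) i : K) / π) = rowMul B c := by
      ext i
      have : ((d ᵥ* A.1) i : K) = ∑ j, (d j : K) * (A.1 j i : K) := by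
        simp [Matrix.vecMul, dotProduct]
      rw [this, Finset.sum_div]
      change _ = ∑ j, c j * (A.1 j i : K)
      refine Finset.sum_congr rfl fun j _ => ?_
      change (π : K) * c j * _ / π = _
      field_simp
    have h2 : (fun i => Ideal.Quotient.mk (Ideal.span {π}) ((d ᵥ* A.1) i)) =
        ∑ j, Ideal.Quotient.mk (Ideal.span {π}) (d j) • b j := by
      ext i
      simp [Matrix.vecMul, dotProduct, hA]
    rw [← h1, ← mem_reduction_iff hπ h, h2, ← hM, b.mem_span_image]
    have h3 : ∀ i, b.repr (∑ j, Ideal.Quotient.mk (Ideal.span {π}) (d j) • b j) i =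
        Ideal.Quotient.mk (Ideal.span {π}) (d i) := fun i => by rw [b.repr_sum_self]
    rw [Set.subset_def]
    refine forall_congr' fun i => ?_
    rw [Finset.mem_coe, Finsupp.mem_support_iff, h3, Ne, mk_span_eq_zero_iff hπ]
    have h4 : (d i : K) / π = c i := mul_div_cancel_left₀ _ hπ0
    rw [h4]
    split_ifs with hp
    · simp only [Set.mem_ofPred_eq, hp, implies_true, true_iff]
      rw [mul_comm]
      exact hc i
    · simp [hp]
  constructor
  · intro hx
    refine (key ?_).mp hx
    have h1 := h' hx
    rw [← OLattice.mem_smul_iff, smul_comm, hB, map_smul_stdLattice] at h1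
    exact (mem_inv_unif_smul_stdLattice hπ c).mp h1
  · intro hx
    refine (key fun i => ?_).mpr hx
    have := hx i
    split_ifs at this
    · rwa [mul_comm]
    · rw [mul_one] at this
      exact mul_mem π.2 this

/-- `GL_r(K)` acts transitively on the chains `L ≤ W' ⋖ W ≤ π⁻¹ L` with `[W : L]` given. -/
theorem exists_smul_flag_eq [IsDiscreteValuationRing 𝒪[K]] (hπ : Irreducible π)
    {L W' W : OLattice K r} (h₁ : L ≤ W') (h₂ : W' ⋖ W) (h₃ : W ≤ (unif hπ)⁻¹ • L) :
    ∃ (g : GL (Fin r) K) (s : ℕ), 1 ≤ s ∧ s ≤ r ∧ g • stdLattice K r = L ∧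
      g • diagGL hπ r s • stdLattice K r = W ∧ g • diagGL hπ r s • stdSublattice hπ r = W' := by
  obtain ⟨g₀, rfl⟩ := exists_smul_stdLattice_eq L
  obtain ⟨W, rfl⟩ := MulAction.surjective g₀ W
  obtain ⟨W', rfl⟩ := MulAction.surjective g₀ W'
  rw [smul_comm, OLattice.smul_le_smul_iff] at h₃
  rw [OLattice.smul_le_smul_iff] at h₁
  rw [OLattice.smul_covBy_smul_iff] at h₂
  obtain ⟨y, hy, hyW⟩ := reduction_eq_sup_of_covBy hπ h₂ h₁ h₃
  have hmax : (Ideal.span {π}).IsMaximal := by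
    rw [← hπ.maximalIdeal_eq]
    infer_instance
  let _ : Field (ResField π) := Ideal.Quotient.field _
  obtain ⟨b, s, hs, hsr, hb, hb'⟩ := exists_basis_flag (r := r) (by simp) (reduction π W') hy
  obtain ⟨A, hA⟩ := exists_lift_basis hπ b
  -- The factor `g₀` moves `Λ₀` to `L`. The inverse of the lifted matrix fixes `Λ₀` and moves the
  -- two standard lattices to the given ones, because rows act through `g⁻¹`.
  refine ⟨g₀ * (Matrix.GeneralLinearGroup.map (algebraMap 𝒪[K] K) A)⁻¹, s, hs, hsr, ?_, ?_, ?_⟩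
  · rw [mul_smul, ← map_inv, map_smul_stdLattice]
  · rw [mul_smul]
    congr 1
    refine OLattice.ext_mem fun x => ?_
    rw [OLattice.mem_smul_iff, mem_diagGL_smul,
      mem_iff_of_reduction_eq hπ (h₁.trans h₂.le) h₃ b A hA _ (hb.trans hyW.symm)]
  · rw [mul_smul]
    congr 1
    refine OLattice.ext_mem fun x => ?_
    rw [OLattice.mem_smul_iff, mem_diagGL_smul_stdSublattice hπ hs,
      mem_iff_of_reduction_eq hπ h₁ (h₂.le.trans h₃) b A hA _ hb']

end Flags

/-! ### Covers of lattices are the edges of type 1 -/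

section Covers

variable {K : Type*} [Field K] [ValuativeRel K] {r : ℕ} {π : 𝒪[K]}

/-- A vector of `Λ₀` outside `Λ₁` has a unit as first coordinate, so subtracting a multiple of it
brings any vector of `Λ₀` into `Λ₁`. -/
theorem stdSublattice_covBy (hπ : Irreducible π) (hr : 1 ≤ r) [IsDiscreteValuationRing 𝒪[K]] :
    stdSublattice hπ r ⋖ stdLattice K r := by
  have hπ0 := uniformizer_ne_zero hπ
  let i₀ : Fin r := ⟨0, hr⟩
  have hmem : ∀ x ∈ (stdLattice K r).1, x ∈ (stdSublattice hπ r).1 ↔ x i₀ / π ∈ 𝒪[K] := by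
    intro x hx
    rw [mem_stdSublattice]
    refine ⟨fun h => by simpa [i₀, div_eq_mul_inv] using h i₀, fun h i => ?_⟩
    split_ifs with hi
    · rwa [show i = i₀ from Fin.ext (by simpa using hi), ← div_eq_mul_inv]
    · rw [mul_one]
      exact hx i
  have hle : stdSublattice hπ r ≤ stdLattice K r := by
    intro x hx i
    have := (mem_stdSublattice hπ x).mp hx i
    split_ifs at this
    · have h := mul_mem this π.2
      rwa [mul_assoc, inv_mul_cancel₀ hπ0, mul_one] at h
    · rwa [mul_one] at this
  refine ⟨lt_of_le_not_ge hle fun h => ?_, fun M h h' => ?_⟩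
  · have h1 : (fun _ => 1) ∈ (stdLattice K r).1 := fun _ => one_mem _
    exact inv_unif_not_mem hπ _ ((hmem _ h1).mp (h h1)) (div_mul_cancel₀ _ hπ0)
  · refine h'.not_ge fun y hy => ?_
    obtain ⟨x, hx, hx'⟩ := SetLike.exists_of_lt (p := (stdSublattice hπ r).1) (q := M.1) h
    have hxΛ := h'.le hx
    rw [hmem x hxΛ] at hx'
    have hx0 : x i₀ ≠ 0 := fun h0 => hx' (by rw [h0, zero_div]; exact zero_mem _)
    have hinv : (x i₀)⁻¹ ∈ 𝒪[K] := by
      rcases units_trichotomy hπ (Units.mk0 _ hx0) with h1 | h1 | h1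
      · simpa using h1.2
      · exact absurd h1 hx'
      · have := mul_mem π.2 h1
        rw [mul_div_cancel₀ _ hπ0] at this
        simpa using this
    -- The multiplier `y₀ / x₀` cancels the first coordinate of `y`.
    let c : 𝒪[K] := ⟨_, mul_mem (hy i₀) hinv⟩
    have h2 : y - c • x ∈ (stdLattice K r).1 := sub_mem hy ((stdLattice K r).1.smul_mem c hxΛ)
    have h3 : y - c • x ∈ M.1 := h.le ((hmem _ h2).mpr (by
      have : (y - c • x) i₀ = 0 := by
        change y i₀ - y i₀ * (x i₀)⁻¹ * x i₀ = 0
        rw [mul_assoc, inv_mul_cancel₀ hx0, mul_one, sub_self]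
      rw [this, zero_div]
      exact zero_mem _))
    simpa using M.1.add_mem h3 (M.1.smul_mem c hx)

variable [IsDiscreteValuationRing 𝒪[K]]

/-- The lattice `L + πW` lies between `L` and `W`, hence is one of them. By Nakayama `L + πW = W`
would give `W ≤ L`, so `πW ≤ L`. -/
theorem le_inv_unif_smul_of_covBy (hπ : Irreducible π) {L W : OLattice K r} (h : L ⋖ W) :
    W ≤ (unif hπ)⁻¹ • L := by
  rw [← unif_smul_le_iff]
  have := L.2
  have hW := W.2
  let N : OLattice K r := ⟨L.1 ⊔ (unif hπ • W).1,
    Submodule.IsLattice.of_le_of_isLattice_of_fg K le_sup_left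
      (L.2.fg.sup (unif hπ • W).2.fg)⟩
  have h1 : N ≤ W :=
    sup_le (show L.1 ≤ W.1 from h.le) (show (unif hπ • W).1 ≤ W.1 from unif_smul_le hπ W)
  have h2 : ¬ L < N := by
    intro h2
    have h3 : N = W := h1.eq_of_not_lt (h.2 h2)
    refine h.1.not_ge (Submodule.le_of_le_smul_of_le_jacobson_bot (I := Ideal.span {π})
      hW.fg ?_ ?_)
    · rw [← hπ.maximalIdeal_eq]
      exact IsLocalRing.maximalIdeal_le_jacobson _
    · refine (show W.1 ≤ N.1 from h3.ge).trans (sup_le_sup_left ?_ _)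
      rintro _ ⟨y, hy, rfl⟩
      exact Submodule.smul_mem_smul (Ideal.mem_span_singleton_self π) hy
  have h3 : N = L := by
    by_contra hne
    exact h2 (lt_of_le_of_ne (le_sup_left : L.1 ≤ _) (Ne.symm hne))
  exact le_trans (le_sup_right : _ ≤ N.1) h3.le

/-- This is `exists_smul_flag_eq` with `W' = L`, the diagonal matrix being absorbed into the group
element. It makes the edges of type 1 a single orbit. -/
theorem exists_smul_eq_of_covBy (hπ : Irreducible π) {L W : OLattice K r} (h : L ⋖ W) :
    ∃ g : GL (Fin r) K, g • stdLattice K r = W ∧ g • stdSublattice hπ r = L := by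
  obtain ⟨g, s, -, -, -, h1, h2⟩ :=
    exists_smul_flag_eq hπ le_rfl h (le_inv_unif_smul_of_covBy hπ h)
  exact ⟨g * diagGL hπ r s, by rw [mul_smul, h1], by rw [mul_smul, h2]⟩

theorem adj_of_covBy (hπ : Irreducible π) (hr : 2 ≤ r) {L W : OLattice K r} (h : L ⋖ W) :
    Adj π W L := by
  obtain ⟨g, rfl, rfl⟩ := exists_smul_eq_of_covBy hπ h
  exact (adj_std hπ le_rfl hr).smul g

/-- Dimension one over `F_q` means that the quotient is simple, and a simple quotient means a cover.
The criterion holds for every representing pair, since two of them differ by a common scalar. -/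
theorem OrientedEdge.hasType_one_mk_iff (hπ : Irreducible π) {L₀ L₁ : OLattice K r}
    (h : Adj π L₀ L₁) : (OrientedEdge.mk L₀ L₁ h).HasType 1 ↔ L₁ ⋖ L₀ := by
  have key : ∀ {M₀ M₁ : OLattice K r} (hM : Adj π M₀ M₁),
      quotDim π M₀ M₁ hM.2.le = 1 ↔ M₁ ⋖ M₀ := by
    intro M₀ M₁ hM
    have hmax : (Ideal.span {π}).IsMaximal := by
      rw [← hπ.maximalIdeal_eq]
      infer_instance
    let _ : Field (ResField π) := Ideal.Quotient.field _
    let _ := quotModule π M₀ M₁ hM.2.le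
    -- Every submodule between two lattices is a lattice, as `O` is noetherian, so covers among
    -- lattices and among submodules agree.
    have h1 : M₁ ⋖ M₀ ↔ M₁.1 ⋖ M₀.1 := by
      constructor
      · refine fun h => ⟨h.1, fun N hN hN' => ?_⟩
        have := M₁.2
        have := M₀.2
        have hfg : N.FG := by
          have : IsNoetherian 𝒪[K] N := isNoetherian_of_le hN'.le
          rw [← Module.Finite.iff_fg]
          infer_instance
        exact h.2 (c := ⟨N, Submodule.IsLattice.of_le_of_isLattice_of_fg K hN.le hfg⟩) hN hN'
      · exact fun h => ⟨h.1, fun N hN hN' => h.2 hN hN'⟩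
    rw [h1, covBy_iff_quot_is_simple hM.1.le]
    change Module.finrank (ResField π) (M₀.1 ⧸ M₁.1.submoduleOf M₀.1) = 1 ↔ _
    rw [← isSimpleModule_iff_finrank_eq_one]
    -- The identity is semilinear along `O → F_q`, which transfers simplicity between the two scalar
    -- rings.
    let F : (M₀.1 ⧸ M₁.1.submoduleOf M₀.1) →ₛₗ[Ideal.Quotient.mk (Ideal.span {π})]
        (M₀.1 ⧸ M₁.1.submoduleOf M₀.1) :=
      { toFun := id
        map_add' := fun _ _ => rfl
        map_smul' := fun _ _ => rfl }
    exact (F.isSimpleModule_iff_of_bijective Function.bijective_id).symm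
  constructor
  · rintro ⟨M₀, M₁, hM, e, hdim⟩
    obtain ⟨α, rfl, rfl⟩ := (mk_eq_mk_iff hπ).mp e
    rw [key hM, OLattice.units_smul_covBy_smul_iff] at hdim
    exact hdim
  · exact fun h' => ⟨L₀, L₁, h, rfl, (key h).mpr h'⟩

end Covers

/-! ### The stabilizer of the standard edge -/

section Stabilizer

variable {K : Type*} [Field K] [ValuativeRel K] {r : ℕ} {π : 𝒪[K]}

theorem scalar_smul (α : Kˣ) (L : OLattice K r) :
    Matrix.GeneralLinearGroup.scalar (Fin r) α • L = α⁻¹ • L := by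
  refine OLattice.ext_mem fun x => ?_
  rw [OLattice.mem_smul_iff, OLattice.mem_units_smul_iff, Units.val_inv_eq_inv_val, inv_inv]
  have : rowMul (Matrix.GeneralLinearGroup.scalar (Fin r) α) x = (α : K) • x := by
    rw [rowMul_apply]
    ext i
    simp [Matrix.vecMul_diagonal, mul_comm]
  rw [this]

theorem smul_stdSublattice_of_mem_parahoric (hπ : Irreducible π) {g : GL (Fin r) K}
    (hg : g ∈ parahoric π r 1) :
    g • stdLattice K r = stdLattice K r ∧ g • stdSublattice hπ r = stdSublattice hπ r := by
  have hπ0 := uniformizer_ne_zero hπ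
  have key : ∀ g ∈ parahoric π r 1, stdSublattice hπ r ≤ g • stdSublattice hπ r := by
    rintro _ ⟨A, hA, rfl⟩ x hx
    have hx1 := (mem_stdSublattice hπ x).mp hx
    rw [OLattice.mem_smul_iff, mem_stdSublattice]
    intro i
    change (∑ j, x j * ((A.1 j i : 𝒪[K]) : K)) * _ ∈ 𝒪[K]
    rw [Finset.sum_mul]
    refine sum_mem fun j _ => ?_
    have hxj := hx1 j
    have hxj' : x j ∈ 𝒪[K] := by
      split_ifs at hxj
      · have h := mul_mem hxj π.2
        rwa [mul_assoc, inv_mul_cancel₀ hπ0, mul_one] at h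
      · rwa [mul_one] at hxj
    by_cases hi : i.val < 1
    · rw [if_pos hi]
      by_cases hj : j.val < 1
      · rw [if_pos hj] at hxj
        rw [mul_right_comm]
        exact mul_mem hxj (A.1 j i).2
      · obtain ⟨c, hc⟩ := hA j i (not_lt.mp hj) hi
        rw [hc, mul_assoc]
        change x j * ((π : K) * (c : K) * (π : K)⁻¹) ∈ 𝒪[K]
        rw [mul_right_comm, mul_inv_cancel₀ hπ0, one_mul]
        exact mul_mem hxj' c.2
    · rw [if_neg hi, mul_one]
      exact mul_mem hxj' (A.1 j i).2
  constructor
  · obtain ⟨A, -, rfl⟩ := hg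
    exact map_smul_stdLattice A
  · refine le_antisymm ?_ (key g hg)
    have := key g⁻¹ (inv_mem hg)
    rwa [← OLattice.smul_le_smul_iff g, smul_inv_smul] at this

/-- Preserving `Λ₀` makes `g` and `g⁻¹` integral. For `i ≥ 1` the vector `e_i` lies in `Λ₁`, hence
so does its image, row `i` of `g`, whose first entry is therefore divisible by `π`. -/
theorem mem_parahoric_of_smul_eq (hπ : Irreducible π) {g : GL (Fin r) K}
    (h₀ : g • stdLattice K r = stdLattice K r)
    (h₁ : g • stdSublattice hπ r = stdSublattice hπ r) : g ∈ parahoric π r 1 := by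
  have hπ0 := uniformizer_ne_zero hπ
  have hrow : ∀ (g : GL (Fin r) K) (i : Fin r), rowMul g (Pi.single i 1) = g.1 i := by
    intro g i
    rw [rowMul_apply, Matrix.single_one_vecMul]
    rfl
  have hint : ∀ g : GL (Fin r) K, g • stdLattice K r = stdLattice K r → ∀ i j, g.1 i j ∈ 𝒪[K] := by
    intro g hg i j
    rw [← hrow]
    refine (mem_smul_stdLattice g _).mp ?_ j
    rw [hg]
    intro j
    rw [Pi.single_apply]
    split_ifs
    · exact one_mem _
    · exact zero_mem _
  have h₀' : g⁻¹ • stdLattice K r = stdLattice K r := by rw [inv_smul_eq_iff, h₀]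
  have hinj : Function.Injective (fun M : Matrix (Fin r) (Fin r) 𝒪[K] =>
      M.map (algebraMap 𝒪[K] K)) := Matrix.map_injective Subtype.val_injective
  let A : GL (Fin r) 𝒪[K] :=
    { val := Matrix.of fun i j => ⟨_, hint g h₀ i j⟩
      inv := Matrix.of fun i j => ⟨_, hint g⁻¹ h₀' i j⟩
      val_inv := hinj (by
        simp only [Matrix.map_mul]
        rw [Matrix.map_one _ (map_zero _) (map_one _)]
        exact g.mul_inv)
      inv_val := hinj (by
        simp only [Matrix.map_mul]
        rw [Matrix.map_one _ (map_zero _) (map_one _)]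
        exact g.inv_mul) }
  refine ⟨A, fun i j hi hj => ?_, Units.ext rfl⟩
  have h2 : rowMul g (Pi.single i 1) ∈ (stdSublattice hπ r).1 := by
    rw [← OLattice.mem_smul_iff, h₁, mem_stdSublattice]
    intro l
    rw [Pi.single_apply]
    split_ifs with h3 h4
    · omega
    · rw [mul_one]; exact one_mem _
    · rw [zero_mul]; exact zero_mem _
    · rw [zero_mul]; exact zero_mem _
  have h3 := (mem_stdSublattice hπ _).mp h2 j
  rw [hrow, if_pos hj] at h3
  refine ⟨⟨_, h3⟩, Subtype.ext ?_⟩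
  change g.1 i j = (π : K) * (g.1 i j * (π : K)⁻¹)
  field_simp

theorem scalarParahoric_le_stabilizer (hπ : Irreducible π) (hr : 2 ≤ r) :
    scalarParahoric π r 1 ≤ MulAction.stabilizer (GL (Fin r) K) (stdEdge hπ le_rfl hr) := by
  refine sup_le ?_ ?_
  · rintro _ ⟨α, rfl⟩
    refine Subtype.ext (Prod.ext ?_ ?_) <;>
    · refine (smul_cls _ _).trans ?_
      rw [scalar_smul, cls_units_smul]
      rfl
  · intro g hg
    obtain ⟨h1, h2⟩ := smul_stdSublattice_of_mem_parahoric hπ hg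
    refine Subtype.ext (Prod.ext ?_ ?_)
    · exact (smul_cls _ _).trans (congrArg _ h1)
    · exact (smul_cls _ _).trans (congrArg _ h2)

end Stabilizer

/-! ### Harmonicity as a property of pairs of lattices -/

section PairHarmonic

variable {K : Type*} [Field K] [ValuativeRel K] {r : ℕ} {π : 𝒪[K]} {R : Type*} [AddCommGroup R]

/-- The lattices `ℓ ≤ W` that cover `L`; they are the lines of `W / L` when `π W ≤ L`. -/
def covers (L W : OLattice K r) : Set (OLattice K r) :=
  {ℓ | L ⋖ ℓ ∧ ℓ ≤ W}

/-- Harmonicity of a function of the pairs of lattices `L ≤ W ≤ π⁻¹ L`. -/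
structure IsPairHarmonic (hπ : Irreducible π) (Q : OLattice K r → OLattice K r → R) : Prop where
  scale : ∀ (α : Kˣ) (W L : OLattice K r), Q (α • W) (α • L) = Q W L
  add : ∀ {L W' W : OLattice K r}, L ≤ W' → W' ≤ W → W ≤ (unif hπ)⁻¹ • L →
    Q W L = Q W W' + Q W' L
  full : ∀ L : OLattice K r, Q ((unif hπ)⁻¹ • L) L = 0
  lines : ∀ {L W : OLattice K r}, L ≤ W → W ≤ (unif hπ)⁻¹ • L →
    ∑ᶠ ℓ ∈ covers L W, Q ℓ L = Q W L

theorem IsPairHarmonic.self_eq_zero {hπ : Irreducible π} {Q : OLattice K r → OLattice K r → R}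
    (hQ : IsPairHarmonic hπ Q) (L : OLattice K r) : Q L L = 0 := by
  have := hQ.add le_rfl le_rfl (le_inv_unif_smul hπ L)
  simpa using this

theorem OrientedEdge.exists_eq_mk (e : OrientedEdge π r) :
    ∃ (L₀ L₁ : OLattice K r) (h : Adj π L₀ L₁), e = .mk L₀ L₁ h := by
  obtain ⟨L₀, L₁, h₀, h₁, h⟩ := e.2
  exact ⟨L₀, L₁, h, Subtype.ext (Prod.ext h₀.symm h₁.symm)⟩

open Classical in
/-- The edge `([L₀], [L₁])`, with the standard edge as the default value. -/
def pairEdge (hπ : Irreducible π) (hr : 2 ≤ r) (L₀ L₁ : OLattice K r) : OrientedEdge π r :=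
  if h : Adj π L₀ L₁ then .mk L₀ L₁ h else stdEdge hπ le_rfl hr

theorem pairEdge_of_adj {hπ : Irreducible π} {hr : 2 ≤ r} {L₀ L₁ : OLattice K r}
    (h : Adj π L₀ L₁) : pairEdge hπ hr L₀ L₁ = .mk L₀ L₁ h :=
  dif_pos h

open Classical in
/-- A function on the edges as a function of pairs of lattices. -/
def pairFunction (h : OrientedEdge π r → R) (L₀ L₁ : OLattice K r) : R :=
  if H : Adj π L₀ L₁ then h (.mk L₀ L₁ H) else 0

theorem pairFunction_of_adj (h : OrientedEdge π r → R) {L₀ L₁ : OLattice K r}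
    (H : Adj π L₀ L₁) : pairFunction h L₀ L₁ = h (.mk L₀ L₁ H) :=
  dif_pos H

theorem pairFunction_of_not_adj (h : OrientedEdge π r → R) {L₀ L₁ : OLattice K r}
    (H : ¬ Adj π L₀ L₁) : pairFunction h L₀ L₁ = 0 :=
  dif_neg H

/-- A function of pairs of lattices as a function on the edges. -/
def edgeFunction (Q : OLattice K r → OLattice K r → R) (e : OrientedEdge π r) : R :=
  Q e.2.choose e.2.choose_spec.choose

variable [IsDiscreteValuationRing 𝒪[K]]

/-- The chosen representatives differ from the given ones by a common scalar, which
`IsPairHarmonic.scale` removes. -/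
theorem edgeFunction_mk {hπ : Irreducible π} {Q : OLattice K r → OLattice K r → R}
    (hQ : IsPairHarmonic hπ Q) {L₀ L₁ : OLattice K r} (h : Adj π L₀ L₁) :
    edgeFunction Q (OrientedEdge.mk L₀ L₁ h) = Q L₀ L₁ := by
  set e := OrientedEdge.mk L₀ L₁ h with he
  obtain ⟨h1, h2, h3⟩ := e.2.choose_spec.choose_spec
  have h4 : e = OrientedEdge.mk _ _ h3 := Subtype.ext (Prod.ext h1.symm h2.symm)
  obtain ⟨α, h5, h6⟩ := (OrientedEdge.mk_eq_mk_iff hπ).mp h4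
  change Q e.2.choose e.2.choose_spec.choose = _
  exact (congrArg₂ Q h5.symm h6.symm).trans (hQ.scale α L₀ L₁)

/-- Two covers of `L` giving the same edge differ by a scalar that fixes `L`, which is a unit of `O`
and so fixes the cover too. -/
theorem injOn_pairEdge (hπ : Irreducible π) (hr : 2 ≤ r) (L : OLattice K r) :
    Set.InjOn (fun ℓ => pairEdge hπ hr ℓ L) {ℓ | L ⋖ ℓ} := by
  intro ℓ hℓ ℓ' hℓ' e
  have h := adj_of_covBy hπ hr hℓ
  have h' := adj_of_covBy hπ hr hℓ'
  simp only [pairEdge_of_adj h, pairEdge_of_adj h'] at e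
  obtain ⟨α, h1, h2⟩ := (OrientedEdge.mk_eq_mk_iff hπ).mp e
  obtain ⟨h3, h4⟩ := units_of_smul_between hπ h (α := α) (by rwa [h2])
  rw [← h1, units_smul_eq_self h3 h4]

theorem bijOn_triangle (hπ : Irreducible π) (hr : 2 ≤ r) {L₀ L₁ : OLattice K r}
    (h : Adj π L₀ L₁) : Set.BijOn (fun ℓ => pairEdge hπ hr ℓ L₁) (covers L₁ L₀)
      (OrientedEdge.mk L₀ L₁ h).triangle := by
  refine ⟨fun ℓ hℓ => ?_, (injOn_pairEdge hπ hr L₁).mono fun ℓ hℓ => hℓ.1, ?_⟩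
  · have h' := adj_of_covBy hπ hr hℓ.1
    simp only [pairEdge_of_adj h']
    exact ⟨(OrientedEdge.hasType_one_mk_iff hπ h').mpr hℓ.1, L₀, ℓ, L₁, h, h', rfl, rfl, hℓ.2⟩
  · rintro _ ⟨h1, M₀, ℓ, M₁, hM, hℓ, e, rfl, hle⟩
    obtain ⟨α, rfl, rfl⟩ := (OrientedEdge.mk_eq_mk_iff hπ).mp e.symm
    rw [OrientedEdge.hasType_one_mk_iff hπ] at h1
    refine ⟨α • ℓ, ⟨(OLattice.units_smul_covBy_smul_iff α).mpr h1,
      (OLattice.units_smul_le_smul_iff α).mpr hle⟩, ?_⟩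
    simp only
    rw [pairEdge_of_adj ((adj_units_smul_iff hπ α).mpr hℓ), OrientedEdge.mk_units_smul]

theorem bijOn_typeTerminus_one (hπ : Irreducible π) (hr : 2 ≤ r) (L : OLattice K r) :
    Set.BijOn (fun ℓ => pairEdge hπ hr ℓ L) (covers L ((unif hπ)⁻¹ • L))
      (OrientedEdge.typeTerminus 1 L.cls) := by
  refine ⟨fun ℓ hℓ => ?_, (injOn_pairEdge hπ hr L).mono fun ℓ hℓ => hℓ.1, ?_⟩
  · have h' := adj_of_covBy hπ hr hℓ.1
    simp only [pairEdge_of_adj h']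
    exact ⟨(OrientedEdge.hasType_one_mk_iff hπ h').mpr hℓ.1, rfl⟩
  · rintro e ⟨h1, h2⟩
    obtain ⟨ℓ, M, h, rfl, -⟩ := id h1
    rw [OrientedEdge.hasType_one_mk_iff hπ] at h1
    obtain ⟨α, rfl⟩ := cls_eq_iff.mp (show M.cls = L.cls from h2)
    have h3 : α • M ⋖ α • ℓ := (OLattice.units_smul_covBy_smul_iff α).mpr h1
    refine ⟨α • ℓ, ⟨h3, le_inv_unif_smul_of_covBy hπ h3⟩, ?_⟩
    simp only
    rw [pairEdge_of_adj ((adj_units_smul_iff hπ α).mpr h), OrientedEdge.mk_units_smul]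

/-- Edges of type 1 form one orbit, and an element carrying one to another with the same terminus
automatically fixes that terminus. This provides the symmetry for the double counting. -/
theorem exists_smul_eq_of_mem_typeTerminus_one (hπ : Irreducible π) {v : Vertex K r}
    {e e' : OrientedEdge π r} (he : e ∈ OrientedEdge.typeTerminus 1 v)
    (he' : e' ∈ OrientedEdge.typeTerminus 1 v) : ∃ g : GL (Fin r) K, g • e = e' ∧ g • v = v := by
  suffices h : ∃ g : GL (Fin r) K, g • e = e' by
    obtain ⟨g, rfl⟩ := h
    exact ⟨g, rfl, (congrArg (g • ·) he.2).symm.trans he'.2⟩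
  obtain ⟨L₀, L₁, h, rfl, -⟩ := id he.1
  obtain ⟨M₀, M₁, h', rfl, -⟩ := id he'.1
  obtain ⟨g, rfl, rfl⟩ :=
    exists_smul_eq_of_covBy hπ ((OrientedEdge.hasType_one_mk_iff hπ h).mp he.1)
  obtain ⟨g', rfl, rfl⟩ :=
    exists_smul_eq_of_covBy hπ ((OrientedEdge.hasType_one_mk_iff hπ h').mp he'.1)
  refine ⟨g' * g⁻¹, ?_⟩
  rw [OrientedEdge.smul_mk]
  simp only [mul_smul, inv_smul_smul]

end PairHarmonic

/-! ### Harmonic cochains correspond to pair-harmonic functions -/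

section Edges

variable {K : Type*} [Field K] [ValuativeRel K] [TopologicalSpace K] [IsNonarchimedeanLocalField K]
  {r : ℕ} {π : 𝒪[K]} {R : Type*} [AddCommGroup R]

/-- The vanishing of the sums over the edges of type `s` with a given terminus follows from that
for `s = 1`. -/
theorem star_of_star_one (hπ : Irreducible π) {h : OrientedEdge π r → R} (v : Vertex K r) (s : ℕ)
    (hone : ∑ᶠ e ∈ OrientedEdge.typeTerminus (π := π) 1 v, h e = 0)
    (htri : ∀ e, ∑ᶠ e' ∈ OrientedEdge.triangle e, h e' = h e) :
    ∑ᶠ e ∈ OrientedEdge.typeTerminus (π := π) s v, h e = 0 := by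
  classical
  have hS := OrientedEdge.finite_typeTerminus hπ s v
  have hT := OrientedEdge.finite_typeTerminus hπ 1 v
  rw [finsum_mem_eq_finite_toFinset_sum _ hT] at hone
  rw [finsum_mem_eq_finite_toFinset_sum _ hS]
  -- The edges of a triangle set share the terminus of `e`, so the sum can run over all type 1 edges
  -- at `v` with an incidence condition, ready for exchanging the two summations.
  have h1 : ∀ e ∈ hS.toFinset, h e = ∑ e' ∈ hT.toFinset with e' ∈ e.triangle, h e' := by
    intro e he
    rw [← htri e, finsum_mem_eq_finite_toFinset_sum _ (OrientedEdge.finite_triangle hπ e)]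
    refine Finset.sum_congr (Finset.ext fun e' => ?_) fun _ _ => rfl
    rw [Set.Finite.mem_toFinset, Finset.mem_filter, Set.Finite.mem_toFinset]
    refine ⟨fun he' => ⟨⟨he'.1, ?_⟩, he'⟩, fun he' => he'.2⟩
    obtain ⟨-, L₀, L₀', L₁, _, _, rfl, rfl, -⟩ := he'
    exact ((Set.Finite.mem_toFinset hS).mp he).2
  rw [Finset.sum_congr rfl h1, Finset.sum_comm' (t' := hT.toFinset)
    (s' := fun e' => hS.toFinset.filter fun e => e' ∈ e.triangle)
    (by intro e e'; simp only [Finset.mem_filter]; tauto)]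
  simp only [Finset.sum_const]
  -- The number of type `s` edges incident to a given type 1 edge at `v` is constant, by the
  -- transitive action of the stabilizer of `v`. The sum is then `N` times the sum for `s = 1`.
  obtain ⟨N, hN⟩ : ∃ N, ∀ e' ∈ hT.toFinset,
      (hS.toFinset.filter fun e => e' ∈ e.triangle).card = N := by
    rcases hT.toFinset.eq_empty_or_nonempty with h0 | ⟨e₁, he₁⟩
    · exact ⟨0, by simp [h0]⟩
    · refine ⟨(hS.toFinset.filter fun e => e₁ ∈ e.triangle).card, fun e' he' => ?_⟩
      · obtain ⟨g, hg, hgv⟩ := exists_smul_eq_of_mem_typeTerminus_one hπ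
          ((Set.Finite.mem_toFinset hT).mp he') ((Set.Finite.mem_toFinset hT).mp he₁)
        refine Finset.card_nbij' (g • ·) (g⁻¹ • ·) ?_ ?_ (fun _ _ => inv_smul_smul _ _)
          (fun _ _ => smul_inv_smul _ _)
        · intro e he
          simp only [Finset.coe_filter, Set.Finite.mem_toFinset, Set.mem_ofPred_eq] at he ⊢
          have h2 := OrientedEdge.smul_mem_typeTerminus he.1 g
          have h3 := OrientedEdge.smul_mem_triangle he.2 g
          rw [hgv] at h2
          rw [hg] at h3
          exact ⟨h2, h3⟩
        · intro e he
          simp only [Finset.coe_filter, Set.Finite.mem_toFinset, Set.mem_ofPred_eq] at he ⊢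
          have h2 := OrientedEdge.smul_mem_typeTerminus he.1 g⁻¹
          have h3 := OrientedEdge.smul_mem_triangle he.2 g⁻¹
          rw [inv_smul_eq_iff.mpr hgv.symm] at h2
          rw [inv_smul_eq_iff.mpr hg.symm] at h3
          exact ⟨h2, h3⟩
  rw [Finset.sum_congr rfl fun e' he' => by rw [hN e' he'], ← Finset.smul_sum, hone, smul_zero]

theorem IsPairHarmonic.isHarmonic {hπ : Irreducible π} (hr : 2 ≤ r)
    {Q : OLattice K r → OLattice K r → R} (hQ : IsPairHarmonic hπ Q) :
    IsHarmonic hπ (edgeFunction (π := π) Q) := by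
  have htri : ∀ e, ∑ᶠ e' ∈ OrientedEdge.triangle e, edgeFunction Q e' =
      edgeFunction (π := π) Q e := by
    intro e
    obtain ⟨L₀, L₁, h, rfl⟩ := e.exists_eq_mk
    have h2 := (adj_iff hπ).mp h
    rw [edgeFunction_mk hQ, ← hQ.lines h2.1.le h2.2.le]
    symm
    refine finsum_mem_eq_of_bijOn _ (bijOn_triangle hπ hr h) fun ℓ hℓ => ?_
    have h' := adj_of_covBy hπ hr hℓ.1
    rw [pairEdge_of_adj h', edgeFunction_mk hQ]
  refine ⟨?_, fun v s _ _ => star_of_star_one hπ v s ?_ htri, htri, ?_⟩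
  · intro e
    obtain ⟨L₀, L₁, h, rfl⟩ := e.exists_eq_mk
    -- The reverse edge is represented by `(L₁, πL₀)`, or after scaling by `(π⁻¹L₁, L₀)`. Additivity
    -- along `L₁ ≤ L₀ ≤ π⁻¹L₁` then gives the sum `Q(π⁻¹L₁, L₁) = 0`.
    have h' : Adj π L₁ (unif hπ • L₀) := ⟨h.2, smul_lt_smul_unif hπ h.1⟩
    have h2 := (adj_iff hπ).mp h
    have h3 : OrientedEdge.reverse hπ (.mk L₀ L₁ h) = .mk L₁ (unif hπ • L₀) h' :=
      Subtype.ext (Prod.ext rfl (cls_units_smul _ _).symm)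
    rw [h3, edgeFunction_mk hQ, edgeFunction_mk hQ, ← hQ.scale (unif hπ)⁻¹ L₁, inv_smul_smul,
      eq_neg_iff_add_eq_zero, add_comm, ← hQ.add h2.1.le h2.2.le le_rfl, hQ.full]
  · induction v using Quotient.inductionOn with
    | h L =>
      rw [← hQ.full L, ← hQ.lines (le_inv_unif_smul hπ L) le_rfl]
      symm
      refine finsum_mem_eq_of_bijOn _ (bijOn_typeTerminus_one hπ hr L) fun ℓ hℓ => ?_
      have h' := adj_of_covBy hπ hr hℓ.1
      rw [pairEdge_of_adj h', edgeFunction_mk hQ]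
  · intro L₀ L₁ L₂ h₁ h₂ h₃
    refine (congrArg₂ (· + ·) (edgeFunction_mk hQ _) (edgeFunction_mk hQ _)).trans
      (Eq.trans ?_ (edgeFunction_mk hQ _).symm)
    have h4 : L₀ < (unif hπ)⁻¹ • L₂ := (unif_smul_lt_iff hπ).mp h₃
    exact (hQ.add (show L₂ ≤ L₁ from h₂.le) (show L₁ ≤ L₀ from h₁.le) h4.le).symm

theorem IsHarmonic.isPairHarmonic {hπ : Irreducible π} (hr : 2 ≤ r) {h : OrientedEdge π r → R}
    (H : IsHarmonic hπ h) : IsPairHarmonic hπ (pairFunction h) := by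
  -- The default value `0` of `pairFunction` is the correct one at both degenerate ends, `W = L` and
  -- `W = π⁻¹L`, neither of which is an edge.
  have hself : ∀ L : OLattice K r, pairFunction h L L = 0 := fun L =>
    pairFunction_of_not_adj h fun hL => lt_irrefl _ hL.1
  have hfull : ∀ L : OLattice K r, pairFunction h ((unif hπ)⁻¹ • L) L = 0 := fun L =>
    pairFunction_of_not_adj h fun hL => lt_irrefl _ ((adj_iff hπ).mp hL).2
  refine ⟨?_, ?_, hfull, ?_⟩
  · intro α W L
    by_cases hadj : Adj π W L
    · rw [pairFunction_of_adj h hadj, pairFunction_of_adj h ((adj_units_smul_iff hπ α).mpr hadj),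
        OrientedEdge.mk_units_smul]
    · rw [pairFunction_of_not_adj h hadj,
        pairFunction_of_not_adj h (mt (adj_units_smul_iff hπ α).mp hadj)]
  · intro L W' W h1 h2 h3
    rcases h1.eq_or_lt with rfl | h1
    · rw [hself, add_zero]
    rcases h2.eq_or_lt with rfl | h2
    · rw [hself, zero_add]
    have h4 : Adj π W' L := (adj_iff hπ).mpr ⟨h1, h2.trans_le h3⟩
    have h5 : Adj π W W' := (adj_iff hπ).mpr
      ⟨h2, h3.trans_lt ((OLattice.units_smul_lt_smul_iff _).mpr h1)⟩
    rw [pairFunction_of_adj h h4, pairFunction_of_adj h h5]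
    -- At the end `W = π⁻¹L` additivity is the reversal rule; below it, it is the simplex relation.
    rcases h3.eq_or_lt with rfl | h3
    · rw [hfull, H.reverse (.mk W' L h4)]
      have : OrientedEdge.reverse hπ (.mk W' L h4) = .mk ((unif hπ)⁻¹ • L) W' h5 :=
        Subtype.ext (Prod.ext (cls_units_smul _ _).symm rfl)
      rw [this, add_neg_cancel]
    · rw [pairFunction_of_adj h ((adj_iff hπ).mpr ⟨h1.trans h2, h3⟩)]
      exact (H.simplex W W' L h2 h1 ((unif_smul_lt_iff hπ).mpr h3)).symm
  · intro L W h1 h2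
    rcases h1.eq_or_lt with rfl | h1
    · rw [hself]
      have : covers L L = ∅ := Set.eq_empty_of_forall_notMem fun ℓ hℓ => hℓ.1.1.not_ge hℓ.2
      rw [this, finsum_mem_empty]
    have hval : ∀ ℓ ∈ covers L W, pairFunction h ℓ L = h (pairEdge hπ hr ℓ L) := by
      intro ℓ hℓ
      have h' := adj_of_covBy hπ hr hℓ.1
      rw [pairEdge_of_adj h', pairFunction_of_adj h h']
    -- For `W = π⁻¹L` the line sum is the vertex condition with `s = 1`; otherwise it is the
    -- triangle relation.
    rcases h2.eq_or_lt with rfl | h2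
    · rw [hfull, ← H.star L.cls 1 le_rfl hr]
      exact finsum_mem_eq_of_bijOn _ (bijOn_typeTerminus_one hπ hr L) hval
    · have hadj : Adj π W L := (adj_iff hπ).mpr ⟨h1, h2⟩
      rw [pairFunction_of_adj h hadj, ← H.triangle]
      exact finsum_mem_eq_of_bijOn _ (bijOn_triangle hπ hr hadj) hval

end Edges

/-! ### The matrices of the two relations acting on the standard edge -/

section StandardFlags

variable {K : Type*} [Field K] [ValuativeRel K] {r : ℕ} {π : 𝒪[K]}

theorem rowMul_unipGL (hπ : Irreducible π) (s : ℕ) (u : Fin (s - 1) → 𝒪[K]) (x : Fin r → K)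
    (j : Fin r) : rowMul (unipGL hπ r s u) x j =
      if j.val = 0 then π * x j
      else x j + x ⟨0, j.pos⟩ * if h : 1 ≤ j.val ∧ j.val < s then (u ⟨j.val - 1, by omega⟩ : K)
        else 0 := by
  change ∑ i, x i * unipMat π r s u i j = _
  by_cases hj : j.val = 0
  · rw [if_pos hj, Finset.sum_eq_single j]
    · simp [unipMat, hj, mul_comm]
    · intro i _ hij
      simp [unipMat, hij, hj]
    · simp
  · have hne : (⟨0, j.pos⟩ : Fin r) ≠ j := fun h => hj (congrArg Fin.val h).symm
    rw [if_neg hj, Finset.sum_eq_add j ⟨0, j.pos⟩ hne.symm]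
    · simp [unipMat, hj, hne]
    · rintro i - ⟨h1, h2⟩
      have h3 : i.val ≠ 0 := fun h => h2 (Fin.ext h)
      simp [unipMat, h1, h3]
    · simp
    · simp

theorem mem_unipGL_smul (hπ : Irreducible π) (s : ℕ) (u : Fin (s - 1) → 𝒪[K]) (hr : 1 ≤ r)
    (x : Fin r → K) : x ∈ (unipGL hπ r s u • stdLattice K r).1 ↔
      π * x ⟨0, hr⟩ ∈ 𝒪[K] ∧ (∀ j : Fin r, s ≤ j.val → 0 < j.val → x j ∈ 𝒪[K]) ∧
        ∀ (i : Fin (s - 1)) (h : i.val + 1 < r), x ⟨i + 1, h⟩ + x ⟨0, hr⟩ * u i ∈ 𝒪[K] := by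
  rw [mem_smul_stdLattice]
  simp only [rowMul_unipGL]
  constructor
  · refine fun h => ⟨by simpa using h ⟨0, hr⟩, fun j hj hj' => ?_, fun i hi => ?_⟩
    · simpa [hj'.ne', not_lt.mpr hj] using h j
    · have := h ⟨i + 1, hi⟩
      simpa [show i.val + 1 < s by omega] using this
  · rintro ⟨h1, h2, h3⟩ j
    split_ifs with hj hj'
    · rwa [show j = ⟨0, hr⟩ from Fin.ext hj]
    · have := h3 ⟨j.val - 1, by omega⟩ (by simp; omega)
      convert this using 3
      exact Fin.ext (by simp; omega)
    · rw [mul_zero, add_zero]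
      exact h2 j (by omega) (by omega)

/-- All unipotent translates of `e¹` thus have the terminus `[Λ₀]`, so that they are lines over one
lattice. -/
theorem unipGL_smul_stdSublattice (hπ : Irreducible π) (s : ℕ) (u : Fin (s - 1) → 𝒪[K]) :
    unipGL hπ r s u • stdSublattice hπ r = stdLattice K r := by
  have hπ0 := uniformizer_ne_zero hπ
  refine OLattice.ext_mem fun x => ?_
  rw [OLattice.mem_smul_iff, mem_stdSublattice, mem_stdLattice]
  simp only [rowMul_unipGL]
  constructor
  · intro h
    have h0 : ∀ i : Fin r, x ⟨0, i.pos⟩ ∈ 𝒪[K] := fun i => by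
      have := h ⟨0, i.pos⟩
      simpa [mul_comm (π : K), mul_assoc, inv_mul_cancel₀ hπ0] using this
    intro i
    by_cases hi : i.val = 0
    · rw [show i = ⟨0, i.pos⟩ from Fin.ext hi]
      exact h0 i
    · have := h i
      rw [if_neg hi, if_neg (by omega), mul_one] at this
      refine (add_mem_cancel_right ?_).mp this
      split_ifs
      · exact mul_mem (h0 i) (u _).2
      · rw [mul_zero]; exact zero_mem _
  · intro h i
    by_cases hi : i.val = 0
    · rw [if_pos hi, if_pos (by omega), mul_right_comm, mul_inv_cancel₀ hπ0, one_mul]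
      exact h i
    · rw [if_neg hi, if_neg (by omega), mul_one]
      refine add_mem (h i) ?_
      split_ifs
      · exact mul_mem (h _) (u _).2
      · rw [mul_zero]; exact zero_mem _

theorem rowMul_rotGL_of_lt (hπ : Irreducible π) {s : ℕ} (hs : s ≤ r) (x : Fin r → K) (i : Fin r)
    (h : i.val + s < r) : rowMul (rotGL hπ hs) x ⟨i + s, h⟩ = x i := by
  change ∑ a, x a * rotMat π r s a _ = _
  rw [Finset.sum_eq_single i]
  · simp [rotMat]
  · intro a _ ha
    have h1 : ¬ i.val = a.val := fun h' => ha (Fin.ext h'.symm)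
    have h2 : ¬ i.val + s + r = a.val + s := by omega
    simp [rotMat, h1, h2]
  · simp

theorem rowMul_rotGL_of_le (hπ : Irreducible π) {s : ℕ} (hs : s ≤ r) (x : Fin r → K) (i : Fin r)
    (h : r ≤ i.val + s) : rowMul (rotGL hπ hs) x ⟨i + s - r, by omega⟩ = π * x i := by
  change ∑ a, x a * rotMat π r s a _ = _
  rw [Finset.sum_eq_single i]
  · have h1 : ¬ i.val + s - r = i.val + s := by omega
    have h2 : i.val + s - r + r = i.val + s := by omega
    simp only [rotMat, Matrix.of_apply, if_neg h1, if_pos h2, mul_comm]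
  · intro a _ ha
    have h0 : i.val ≠ a.val := fun h' => ha (Fin.ext h'.symm)
    have h1 : ¬ i.val + s - r = a.val + s := by omega
    have h2 : ¬ i.val + s - r + r = a.val + s := by omega
    simp only [rotMat, Matrix.of_apply, if_neg h1, if_neg h2, mul_zero]
  · simp

theorem forall_rotGL_iff (hπ : Irreducible π) {s : ℕ} (hs : s ≤ r) (x : Fin r → K)
    (p : Fin r → K → Prop) : (∀ j, p j (rowMul (rotGL hπ hs) x j)) ↔
      (∀ (i : Fin r) (h : i.val + s < r), p ⟨i + s, h⟩ (x i)) ∧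
        ∀ (i : Fin r) (h : r ≤ i.val + s), p ⟨i + s - r, by omega⟩ (π * x i) := by
  constructor
  · intro h
    constructor
    · intro i hi
      have := h ⟨i + s, hi⟩
      rwa [rowMul_rotGL_of_lt] at this
    · intro i hi
      have := h ⟨i + s - r, by omega⟩
      rwa [rowMul_rotGL_of_le hπ hs x i hi] at this
  · rintro ⟨h1, h2⟩ j
    by_cases hj : s ≤ j.val
    · obtain ⟨i, hi, rfl⟩ : ∃ (i : Fin r) (hi : i.val + s < r), j = ⟨i + s, hi⟩ :=
        ⟨⟨j - s, by omega⟩, by simp; omega, Fin.ext (by simp; omega)⟩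
      rw [rowMul_rotGL_of_lt]
      exact h1 i hi
    · obtain ⟨i, hi, hij⟩ : ∃ i : Fin r, r ≤ i.val + s ∧ j.val = i + s - r :=
        ⟨⟨j + r - s, by omega⟩, by simp; omega, by simp; omega⟩
      rw [show j = ⟨i + s - r, by omega⟩ from Fin.ext hij, rowMul_rotGL_of_le hπ hs x i hi]
      exact h2 i hi

/-- The lattice is `Λ₀` with a pole of order one allowed in the last `s` coordinates. These lattices
form a full flag from `Λ₀` to `π⁻¹Λ₀` as `s` runs from `0` to `r`. -/
theorem mem_rotGL_smul (hπ : Irreducible π) {s : ℕ} (hs : s ≤ r) (x : Fin r → K) :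
    x ∈ (rotGL hπ hs • stdLattice K r).1 ↔
      ∀ i, (if i.val + s < r then x i else π * x i) ∈ 𝒪[K] := by
  rw [mem_smul_stdLattice, forall_rotGL_iff hπ hs x fun _ y => y ∈ 𝒪[K], ← forall_and]
  refine forall_congr' fun i => ?_
  split_ifs with h
  · simp [h, h.not_ge]
  · simp [h, not_lt.mp h]

theorem rotGL_zero_smul (hπ : Irreducible π) (h : 0 ≤ r) :
    rotGL hπ h • stdLattice K r = stdLattice K r :=
  OLattice.ext_mem fun x => by simp [mem_rotGL_smul, mem_stdLattice]

theorem rotGL_self_smul (hπ : Irreducible π) :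
    rotGL hπ (le_refl r) • stdLattice K r = (unif hπ)⁻¹ • stdLattice K r :=
  OLattice.ext_mem fun x => by simp [mem_rotGL_smul, mem_inv_unif_smul_stdLattice]

theorem rotGL_succ_smul_stdSublattice (hπ : Irreducible π) {s : ℕ} (hs : s + 1 ≤ r) :
    rotGL hπ hs • stdSublattice hπ r = rotGL hπ (Nat.le_of_succ_le hs) • stdLattice K r := by
  have hπ0 := uniformizer_ne_zero hπ
  refine OLattice.ext_mem fun x => ?_
  rw [OLattice.mem_smul_iff, mem_stdSublattice, forall_rotGL_iff hπ hs x fun j y =>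
    y * (if j.val < 1 then (π : K)⁻¹ else 1) ∈ 𝒪[K], mem_rotGL_smul, ← forall_and]
  refine forall_congr' fun i => ?_
  rcases lt_trichotomy (i.val + s + 1) r with h | h | h
  · have h1 : i.val + (s + 1) < r := h
    have h2 : i.val + s < r := by omega
    simp [h1, h2, h1.not_ge]
  · have h1 : ¬ i.val + (s + 1) < r := by omega
    have h2 : i.val + s < r := by omega
    have h3 : r ≤ i.val + (s + 1) := by omega
    have h4 : i.val + (s + 1) - r < 1 := by omega
    simp only [h1, h2, h3, h4, IsEmpty.forall_iff, true_and, forall_const, if_true]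
    rw [mul_right_comm, mul_inv_cancel₀ hπ0, one_mul]
  · have h1 : ¬ i.val + (s + 1) < r := by omega
    have h2 : ¬ i.val + s < r := by omega
    have h3 : r ≤ i.val + (s + 1) := by omega
    have h4 : ¬ i.val + (s + 1) - r < 1 := by omega
    simp only [h1, h2, h3, h4, IsEmpty.forall_iff, true_and, forall_const, if_false, mul_one]

end StandardFlags

/-! ### Unipotent matrices parametrize lines outside a hyperplane -/

section Lines

variable {K : Type*} [Field K] [ValuativeRel K] {r : ℕ} {π : 𝒪[K]}

theorem eq_of_covBy_of_mem {L ℓ ℓ' : OLattice K r} (h : L ⋖ ℓ) (h' : L ⋖ ℓ')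
    {x : Fin r → K} (hx : x ∈ ℓ.1) (hx' : x ∈ ℓ'.1) (hxL : x ∉ L.1) : ℓ = ℓ' := by
  refine OLattice.ext_mem fun y => ⟨fun hy => ?_, fun hy => ?_⟩
  · obtain ⟨c, hc⟩ := exists_sub_smul_mem_of_covBy h hx hxL hy
    simpa using ℓ'.1.add_mem (h'.le hc) (ℓ'.1.smul_mem c hx')
  · obtain ⟨c, hc⟩ := exists_sub_smul_mem_of_covBy h' hx' hxL hy
    simpa using ℓ.1.add_mem (h.le hc) (ℓ.1.smul_mem c hx)

variable [IsDiscreteValuationRing 𝒪[K]]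

theorem covBy_unipGL_smul (hπ : Irreducible π) (hr : 1 ≤ r) (s : ℕ) (u : Fin (s - 1) → 𝒪[K]) :
    stdLattice K r ⋖ unipGL hπ r s u • stdLattice K r := by
  have := (OLattice.smul_covBy_smul_iff (unipGL hπ r s u)).mpr (stdSublattice_covBy hπ hr)
  rwa [unipGL_smul_stdSublattice] at this

/-- The lines of the span of the first `s` standard vectors that do not lie in the span of the
vectors `2, …, s` are parametrized by `F_q ^ (s - 1)`. -/
theorem bijOn_unipGL (hπ : Irreducible π) {σ : ResField π → 𝒪[K]}
    (hσ : ∀ a, Ideal.Quotient.mk (Ideal.span {π}) (σ a) = a) {s : ℕ} (hs : 1 ≤ s) (hsr : s ≤ r) :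
    Set.BijOn (fun u : Fin (s - 1) → ResField π =>
        unipGL hπ r s (fun i => σ (u i)) • stdLattice K r) Set.univ
      (covers (stdLattice K r) (diagGL hπ r s • stdLattice K r) \
        covers (stdLattice K r) (diagGL hπ r s • stdSublattice hπ r)) := by
  have hπ0 := uniformizer_ne_zero hπ
  have hr : 1 ≤ r := hs.trans hsr
  let i₀ : Fin r := ⟨0, hr⟩
  have hnot : ∀ x ∈ (stdLattice K r).1, x i₀ ≠ (π : K)⁻¹ := by
    intro x hx h
    exact inv_unif_not_mem hπ _ (h ▸ hx i₀) (inv_mul_cancel₀ hπ0)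
  -- The vector `π⁻¹(1, -c, 0)` is the normalized generator of a line modulo `Λ₀`. It lies in the
  -- line of parameter `u` exactly when `c ≡ u` mod `π`, which yields injectivity and detects the
  -- parameter.
  let y : (Fin (s - 1) → 𝒪[K]) → Fin r → K := fun c j =>
    if h0 : j.val = 0 then (π : K)⁻¹ else
      if h : j.val < s then -((π : K)⁻¹ * c ⟨j.val - 1, by omega⟩) else 0
  have hy : ∀ c u : Fin (s - 1) → 𝒪[K], y c ∈ (unipGL hπ r s u • stdLattice K r).1 ↔
      ∀ i, Ideal.Quotient.mk (Ideal.span {π}) (c i) = Ideal.Quotient.mk (Ideal.span {π}) (u i) := by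
    intro c u
    have h1 : ∀ (i : Fin (s - 1)) (h : i.val + 1 < r), y c ⟨i + 1, h⟩ + y c i₀ * u i =
        ((u i - c i : 𝒪[K]) : K) / π := by
      intro i h
      have h2 : i.val + 1 < s := by omega
      simp only [y, i₀]
      rw [dif_neg (by simp), dif_pos trivial, dif_pos h2]
      simp only [Nat.add_sub_cancel]
      change _ = ((u i : K) - (c i : K)) / π
      field_simp
      ring
    rw [mem_unipGL_smul hπ s u hr]
    constructor
    · rintro ⟨-, -, h⟩ i
      have := h i (by omega)
      rw [h1, ← mk_span_eq_zero_iff hπ, map_sub, sub_eq_zero] at this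
      exact this.symm
    · refine fun h => ⟨?_, fun j hj hj' => ?_, fun i hi => ?_⟩
      · simp [y, mul_inv_cancel₀ hπ0]
      · simp only [y]
        rw [dif_neg hj'.ne', dif_neg (not_lt.mpr hj)]
        exact zero_mem _
      · rw [h1, ← mk_span_eq_zero_iff hπ, map_sub, sub_eq_zero]
        exact (h i).symm
  have hyΛ : ∀ c, y c ∉ (stdLattice K r).1 := fun c hc => hnot _ hc (by simp [y, i₀])
  refine ⟨fun u _ => ⟨⟨covBy_unipGL_smul hπ hr s _, fun x hx => ?_⟩, fun h => ?_⟩, ?_, ?_⟩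
  · obtain ⟨h1, h2, h3⟩ := (mem_unipGL_smul hπ s _ hr x).mp hx
    rw [mem_diagGL_smul]
    intro i
    split_ifs with hi
    · by_cases hi0 : i.val = 0
      · rw [show i = ⟨0, hr⟩ from Fin.ext hi0, mul_comm]
        exact h1
      · have h4 := mul_mem π.2 (h3 ⟨i.val - 1, by omega⟩ (by simp; omega))
        have h5 : (⟨i.val - 1 + 1, by omega⟩ : Fin r) = i := Fin.ext (by simp; omega)
        rw [h5, mul_add, ← mul_assoc] at h4
        rw [mul_comm]
        exact (add_mem_cancel_right (mul_mem h1 (Subtype.property _))).mp h4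
    · rw [mul_one]
      exact h2 i (by omega) (by omega)
  · have h1 := h.2 ((hy (fun i => σ (u i)) (fun i => σ (u i))).mpr fun _ => rfl)
    have h2 := (mem_diagGL_smul_stdSublattice hπ hs _).mp h1 i₀
    simp only [y, i₀, lt_irrefl, false_and, if_false, dif_pos, mul_one] at h2
    exact inv_unif_not_mem hπ _ h2 (inv_mul_cancel₀ hπ0)
  · intro u _ u' _ e
    have h1 := (hy (fun i => σ (u i)) (fun i => σ (u i))).mpr fun _ => rfl
    simp only at e
    rw [e] at h1
    ext i
    have := (hy (fun i => σ (u i)) (fun i => σ (u' i))).mp h1 i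
    rwa [hσ, hσ] at this
  · rintro ℓ ⟨⟨hℓ, hℓW⟩, hℓ'⟩
    have hnle : ¬ ℓ ≤ diagGL hπ r s • stdSublattice hπ r := fun h => hℓ' ⟨hℓ, h⟩
    obtain ⟨x, hx, hx'⟩ := SetLike.not_le_iff_exists (p := ℓ.1).mp hnle
    have hxW := (mem_diagGL_smul hπ s x).mp (hℓW hx)
    have hx0 : x i₀ ∉ 𝒪[K] := by
      refine fun h0 => hx' ((mem_diagGL_smul_stdSublattice hπ hs x).mpr fun i => ?_)
      have h1 := hxW i
      by_cases hi : i.val = 0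
      · rw [show i = i₀ from Fin.ext hi, if_neg (by simp [i₀]), mul_one]
        exact h0
      · simpa [Nat.pos_of_ne_zero hi] using h1
    have hx00 : x i₀ ≠ 0 := fun h => hx0 (h ▸ zero_mem _)
    -- The first coordinate is not integral but becomes so after multiplication by `π`, so `π x₀` is
    -- a unit. Its inverse `a` normalizes the first coordinate of `x` to `π⁻¹`.
    have hinv : (π : K)⁻¹ * (x i₀)⁻¹ ∈ 𝒪[K] := by
      rcases units_trichotomy hπ (Units.mk0 (x i₀ * π) (mul_ne_zero hx00 hπ0)) with h1 | h1 | h1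
      · simpa using h1.2
      · refine absurd ?_ hx0
        simpa [mul_div_cancel_right₀ _ hπ0] using h1
      · have h2 := mul_mem π.2 h1
        rw [mul_div_cancel₀ _ hπ0] at h2
        simpa using h2
    let a : 𝒪[K] := ⟨_, hinv⟩
    have hs1 : ∀ i : Fin (s - 1), i.val + 1 < r := fun i => by omega
    have hc : ∀ i : Fin (s - 1), -(x ⟨i + 1, hs1 i⟩ * (x i₀)⁻¹) ∈ 𝒪[K] := by
      intro i
      have h1 := hxW ⟨i + 1, hs1 i⟩
      rw [if_pos (show i.val + 1 < s by omega)] at h1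
      have h2 := mul_mem h1 hinv
      refine neg_mem ?_
      convert h2 using 1
      field_simp
    let c : Fin (s - 1) → 𝒪[K] := fun i => ⟨_, hc i⟩
    refine ⟨fun i => Ideal.Quotient.mk _ (c i), trivial, ?_⟩
    refine eq_of_covBy_of_mem (covBy_unipGL_smul hπ hr s _) hℓ
      ((hy c _).mpr fun i => (hσ _).symm) ?_ (hyΛ c)
    -- The coordinates from `s` on are integral, so erasing them from `a • x` is a correction inside
    -- `Λ₀`.
    let z : Fin r → K := fun j => if j.val < s then 0 else -(a * x j)
    have hz : z ∈ (stdLattice K r).1 := by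
      intro j
      simp only [z]
      split_ifs with hj
      · exact zero_mem _
      · have := hxW j
        rw [if_neg hj, mul_one] at this
        exact neg_mem (mul_mem a.2 this)
    have h1 : y c = a • x + z := by
      ext j
      change _ = (π : K)⁻¹ * (x i₀)⁻¹ * x j + z j
      simp only [y, z]
      by_cases hj0 : j.val = 0
      · rw [dif_pos hj0, if_pos (by omega), show j = i₀ from Fin.ext hj0]
        field_simp
        simp
      · rw [dif_neg hj0]
        split_ifs with hj
        · change -((π : K)⁻¹ * -(x ⟨j.val - 1 + 1, _⟩ * (x i₀)⁻¹)) = _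
          have h5 : (⟨j.val - 1 + 1, by omega⟩ : Fin r) = j := Fin.ext (by simp; omega)
          rw [h5]
          ring
        · change _ = _ + -((π : K)⁻¹ * (x i₀)⁻¹ * x j)
          ring
    rw [h1]
    exact ℓ.1.add_mem (ℓ.1.smul_mem a hx) (hℓ.le hz)

end Lines

/-! ### Full flags, and functions on the group as functions of covers -/

section Chains

variable {K : Type*} [Field K] [ValuativeRel K] {r : ℕ} {π : 𝒪[K]} {R : Type*} [AddCommGroup R]

theorem bijOn_smul_covers (g : GL (Fin r) K) (L W : OLattice K r) :
    Set.BijOn (g • ·) (covers L W) (covers (g • L) (g • W)) := by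
  refine ⟨fun ℓ hℓ => ⟨(OLattice.smul_covBy_smul_iff g).mpr hℓ.1,
    (OLattice.smul_le_smul_iff g).mpr hℓ.2⟩, (MulAction.injective g).injOn, ?_⟩
  intro ℓ hℓ
  obtain ⟨ℓ, rfl⟩ := MulAction.surjective g ℓ
  exact ⟨ℓ, ⟨(OLattice.smul_covBy_smul_iff g).mp hℓ.1, (OLattice.smul_le_smul_iff g).mp hℓ.2⟩, rfl⟩

theorem bijOn_units_smul_covers (α : Kˣ) (L W : OLattice K r) :
    Set.BijOn (α • ·) (covers L W) (covers (α • L) (α • W)) := by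
  refine ⟨fun ℓ hℓ => ⟨(OLattice.units_smul_covBy_smul_iff α).mpr hℓ.1,
    (OLattice.units_smul_le_smul_iff α).mpr hℓ.2⟩, (MulAction.injective α).injOn, ?_⟩
  intro ℓ hℓ
  obtain ⟨ℓ, rfl⟩ := MulAction.surjective α ℓ
  exact ⟨ℓ, ⟨(OLattice.units_smul_covBy_smul_iff α).mp hℓ.1,
    (OLattice.units_smul_le_smul_iff α).mp hℓ.2⟩, rfl⟩

theorem diagGL_smul_le (hπ : Irreducible π) (s : ℕ) :
    diagGL hπ r s • stdLattice K r ≤ (unif hπ)⁻¹ • stdLattice K r := by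
  intro x hx
  rw [mem_inv_unif_smul_stdLattice]
  intro i
  have := (mem_diagGL_smul hπ s x).mp hx i
  split_ifs at this
  · rwa [mul_comm]
  · rw [mul_one] at this
    exact mul_mem π.2 this

theorem le_diagGL_smul_stdSublattice (hπ : Irreducible π) {s : ℕ} (hs : 1 ≤ s) :
    stdLattice K r ≤ diagGL hπ r s • stdSublattice hπ r := by
  intro x hx
  rw [mem_diagGL_smul_stdSublattice hπ hs]
  intro i
  split_ifs
  · exact mul_mem (hx i) π.2
  · rw [mul_one]
    exact hx i

open Classical in
/-- The standard full flag from `g O ^ r` to `g π⁻¹ O ^ r`. -/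
def rotFlag (hπ : Irreducible π) (g : GL (Fin r) K) (t : ℕ) : OLattice K r :=
  -- Indices above `r` are never used; the default makes the flag a function on all naturals,
  -- convenient for telescoping over `Finset.range r`.
  if h : t ≤ r then (g * rotGL hπ h) • stdLattice K r else g • stdLattice K r

theorem rotFlag_of_le (hπ : Irreducible π) (g : GL (Fin r) K) {t : ℕ} (h : t ≤ r) :
    rotFlag hπ g t = (g * rotGL hπ h) • stdLattice K r :=
  dif_pos h

/-- Together with `rotFlag_of_le` this identifies the translate of `e¹` by the matrix of index `t +
1` with the step from `t` to `t + 1` of the flag. -/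
theorem rotFlag_of_succ_le (hπ : Irreducible π) (g : GL (Fin r) K) {t : ℕ} (h : t + 1 ≤ r) :
    rotFlag hπ g t = (g * rotGL hπ h) • stdSublattice hπ r := by
  rw [rotFlag_of_le hπ g (Nat.le_of_succ_le h), mul_smul, mul_smul, rotGL_succ_smul_stdSublattice]

theorem rotFlag_zero (hπ : Irreducible π) (g : GL (Fin r) K) :
    rotFlag hπ g 0 = g • stdLattice K r := by
  rw [rotFlag_of_le hπ g (Nat.zero_le r), mul_smul, rotGL_zero_smul]

theorem rotFlag_self (hπ : Irreducible π) (g : GL (Fin r) K) :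
    rotFlag hπ g r = (unif hπ)⁻¹ • g • stdLattice K r := by
  rw [rotFlag_of_le hπ g le_rfl, mul_smul, rotGL_self_smul, smul_comm]

/-- The sum of the second relation in terms of lattices. -/
theorem sum_rotGL_eq (hπ : Irreducible π) (P : OLattice K r → OLattice K r → R)
    (g : GL (Fin r) K) :
    ∑ s : Finset.Icc 1 r, P ((g * rotGL hπ (Finset.mem_Icc.mp s.2).2) • stdLattice K r)
        ((g * rotGL hπ (Finset.mem_Icc.mp s.2).2) • stdSublattice hπ r) =
      ∑ t ∈ Finset.range r, P (rotFlag hπ g (t + 1)) (rotFlag hπ g t) := by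
  have h1 : ∀ s : Finset.Icc 1 r,
      P ((g * rotGL hπ (Finset.mem_Icc.mp s.2).2) • stdLattice K r)
        ((g * rotGL hπ (Finset.mem_Icc.mp s.2).2) • stdSublattice hπ r) =
      P (rotFlag hπ g s) (rotFlag hπ g (s - 1)) := by
    rintro ⟨s, hs⟩
    obtain ⟨hs1, hs2⟩ := Finset.mem_Icc.mp hs
    obtain ⟨t, rfl⟩ := Nat.exists_eq_add_of_le' hs1
    rw [Nat.add_sub_cancel, rotFlag_of_le hπ g hs2, rotFlag_of_succ_le hπ g hs2]
  rw [Finset.sum_congr rfl fun s _ => h1 s,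
    Finset.sum_coe_sort (Finset.Icc 1 r) fun s => P (rotFlag hπ g s) (rotFlag hπ g (s - 1))]
  rw [Finset.range_eq_Ico]
  exact (Finset.sum_Ico_add' (fun s => P (rotFlag hπ g s) (rotFlag hπ g (s - 1))) 0 r 1).symm

open Classical in
/-- A function on `GL_r(K) / Kˣ I^1` as a function of the pairs of lattices `L ⋖ W`. -/
def cosetPair (hπ : Irreducible π) (f : GL (Fin r) K ⧸ scalarParahoric π r 1 → R)
    (L₀ L₁ : OLattice K r) : R :=
  if h : ∃ g : GL (Fin r) K, g • stdLattice K r = L₀ ∧ g • stdSublattice hπ r = L₁ then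
    f (QuotientGroup.mk h.choose) else 0

/-- The chosen matrix and `g` differ on the right by an element fixing `Λ₀` and `Λ₁`, hence lying in
`I^1`, so the choice does not affect the value. -/
theorem cosetPair_smul (hπ : Irreducible π) (f : GL (Fin r) K ⧸ scalarParahoric π r 1 → R)
    (g : GL (Fin r) K) :
    cosetPair hπ f (g • stdLattice K r) (g • stdSublattice hπ r) = f (QuotientGroup.mk g) := by
  have h : ∃ g' : GL (Fin r) K, g' • stdLattice K r = g • stdLattice K r ∧
      g' • stdSublattice hπ r = g • stdSublattice hπ r := ⟨g, rfl, rfl⟩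
  rw [cosetPair, dif_pos h]
  congr 1
  obtain ⟨h1, h2⟩ := h.choose_spec
  refine QuotientGroup.eq.mpr (Subgroup.mem_sup_right (mem_parahoric_of_smul_eq hπ ?_ ?_))
  · rw [mul_smul, inv_smul_eq_iff, h1]
  · rw [mul_smul, inv_smul_eq_iff, h2]

/-- The sum over the lines of `W / L` of a function on `GL_r(K) / Kˣ I^1`. -/
def lineSum (hπ : Irreducible π) (f : GL (Fin r) K ⧸ scalarParahoric π r 1 → R)
    (W L : OLattice K r) : R :=
  ∑ᶠ ℓ ∈ covers L W, cosetPair hπ f ℓ L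

theorem lineSum_of_covBy (hπ : Irreducible π) (f : GL (Fin r) K ⧸ scalarParahoric π r 1 → R)
    {L ℓ : OLattice K r} (h : L ⋖ ℓ) : lineSum hπ f ℓ L = cosetPair hπ f ℓ L := by
  have : covers L ℓ = {ℓ} := by
    ext m
    refine ⟨fun hm => hm.2.eq_of_not_lt (h.2 hm.1.1), ?_⟩
    rintro rfl
    exact ⟨h, le_rfl⟩
  rw [lineSum, this, finsum_mem_singleton]

theorem lineSum_self (hπ : Irreducible π) (f : GL (Fin r) K ⧸ scalarParahoric π r 1 → R)
    (L : OLattice K r) : lineSum hπ f L L = 0 := by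
  have : covers L L = ∅ := Set.eq_empty_of_forall_notMem fun ℓ hℓ => hℓ.1.1.not_ge hℓ.2
  rw [lineSum, this, finsum_mem_empty]

theorem pairFunction_smul_std (hπ : Irreducible π) (hr : 2 ≤ r) (h : OrientedEdge π r → R)
    (g : GL (Fin r) K) :
    pairFunction h (g • stdLattice K r) (g • stdSublattice hπ r) =
      h (g • stdEdge hπ le_rfl hr) :=
  pairFunction_of_adj h ((adj_std hπ le_rfl hr).smul g)

variable [IsDiscreteValuationRing 𝒪[K]]

theorem diagGL_smul_covBy (hπ : Irreducible π) (hr : 1 ≤ r) (s : ℕ) :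
    diagGL hπ r s • stdSublattice hπ r ⋖ diagGL hπ r s • stdLattice K r :=
  (OLattice.smul_covBy_smul_iff _).mpr (stdSublattice_covBy hπ hr)

theorem rotFlag_covBy_succ (hπ : Irreducible π) (g : GL (Fin r) K) {t : ℕ} (h : t + 1 ≤ r) :
    rotFlag hπ g t ⋖ rotFlag hπ g (t + 1) := by
  rw [rotFlag_of_succ_le hπ g h, rotFlag_of_le hπ g h, OLattice.smul_covBy_smul_iff]
  exact stdSublattice_covBy hπ (le_trans (Nat.succ_pos t) h)

theorem rotFlag_mono (hπ : Irreducible π) (g : GL (Fin r) K) {t u : ℕ} (htu : t ≤ u)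
    (hu : u ≤ r) : rotFlag hπ g t ≤ rotFlag hπ g u := by
  induction u, htu using Nat.le_induction with
  | base => exact le_rfl
  | succ u _ ih => exact (ih (by omega)).trans (rotFlag_covBy_succ hπ g hu).le

/-- Scaling is the action of a scalar matrix, which is central and so moves to the right of `g`,
where `f` ignores it. -/
theorem cosetPair_units_smul (hπ : Irreducible π)
    (f : GL (Fin r) K ⧸ scalarParahoric π r 1 → R) (α : Kˣ) {L W : OLattice K r} (h : L ⋖ W) :
    cosetPair hπ f (α • W) (α • L) = cosetPair hπ f W L := by
  obtain ⟨g, rfl, rfl⟩ := exists_smul_eq_of_covBy hπ h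
  rw [← inv_inv α, ← scalar_smul, ← scalar_smul, ← mul_smul, ← mul_smul, cosetPair_smul,
    cosetPair_smul]
  congr 1
  refine (QuotientGroup.eq.mpr (Subgroup.mem_sup_left (MonoidHom.mem_range.mpr ⟨α⁻¹, ?_⟩))).symm
  have : Matrix.GeneralLinearGroup.scalar (Fin r) α⁻¹ * g =
      g * Matrix.GeneralLinearGroup.scalar (Fin r) α⁻¹ :=
    Units.ext (Matrix.scalar_commute _ (fun _ => Commute.all _ _) g.1).eq
  rw [this, inv_mul_cancel_left]

end Chains

/-! ### The two relations as additivity and vanishing, and the isomorphism -/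

section GroupFunctions

variable {K : Type*} [Field K] [ValuativeRel K] [TopologicalSpace K] [IsNonarchimedeanLocalField K]
  {r : ℕ} {π : 𝒪[K]} {R : Type*} [AddCommGroup R]

theorem finite_Icc (hπ : Irreducible π) {L W : OLattice K r} (h : W ≤ (unif hπ)⁻¹ • L) :
    (Set.Icc L W).Finite :=
  haveI := W.2
  (finite_between hπ L.1 W.1 ((unif_smul_le_iff hπ).mpr h)).preimage Subtype.val_injective.injOn

theorem finite_covers (hπ : Irreducible π) {L W : OLattice K r} (h : W ≤ (unif hπ)⁻¹ • L) :
    (covers L W).Finite :=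
  (finite_Icc hπ h).subset fun _ hℓ => ⟨hℓ.1.le, hℓ.2⟩

/-- The sum of the first relation in terms of lattices. -/
theorem finsum_unipGL_add (hπ : Irreducible π) {σ : ResField π → 𝒪[K]}
    (hσ : ∀ a, Ideal.Quotient.mk (Ideal.span {π}) (σ a) = a) {s : ℕ} (hs : 1 ≤ s) (hsr : s ≤ r)
    (P : OLattice K r → OLattice K r → R) (g : GL (Fin r) K) :
    (∑ᶠ u : Fin (s - 1) → ResField π,
        P ((g * unipGL hπ r s fun i => σ (u i)) • stdLattice K r)
          ((g * unipGL hπ r s fun i => σ (u i)) • stdSublattice hπ r)) +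
      ∑ᶠ ℓ ∈ covers (g • stdLattice K r) (g • diagGL hπ r s • stdSublattice hπ r),
        P ℓ (g • stdLattice K r) =
      ∑ᶠ ℓ ∈ covers (g • stdLattice K r) (g • diagGL hπ r s • stdLattice K r),
        P ℓ (g • stdLattice K r) := by
  have hr : 1 ≤ r := hs.trans hsr
  set L := stdLattice K r
  set W := diagGL hπ r s • L
  set W' := diagGL hπ r s • stdSublattice hπ r
  have hsub : covers L W' ⊆ covers L W := fun ℓ hℓ =>
    ⟨hℓ.1, hℓ.2.trans (diagGL_smul_covBy hπ hr s).le⟩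
  have e : ∀ M : OLattice K r, ∑ᶠ ℓ ∈ covers (g • L) (g • M), P ℓ (g • L) =
      ∑ᶠ ℓ ∈ covers L M, P (g • ℓ) (g • L) := fun M =>
    (finsum_mem_eq_of_bijOn _ (bijOn_smul_covers g L M) fun _ _ => rfl).symm
  rw [e, e, ← finsum_mem_univ]
  -- The unipotent sum is the sum over the lines of `W` that are not lines of `W'`.
  have h1 := finsum_mem_eq_of_bijOn (f := fun u : Fin (s - 1) → ResField π =>
    P ((g * unipGL hπ r s fun i => σ (u i)) • L)
      ((g * unipGL hπ r s fun i => σ (u i)) • stdSublattice hπ r))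
    (g := fun ℓ => P (g • ℓ) (g • L)) _ (bijOn_unipGL hπ hσ hs hsr) (by
      intro u _
      rw [mul_smul, mul_smul, unipGL_smul_stdSublattice])
  have hfin : (covers L W).Finite := finite_covers hπ (diagGL_smul_le hπ s)
  rw [h1, ← finsum_mem_union Set.disjoint_sdiff_left hfin.sdiff (hfin.subset hsub),
    Set.sdiff_union_of_subset hsub]

/-- The difference of the line sums of `W` and `W'` is `Q(W, L) - Q(W', L)`, equal to `Q(W, W')` by
additivity. -/
theorem IsPairHarmonic.finsum_unipGL {hπ : Irreducible π} {σ : ResField π → 𝒪[K]}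
    (hσ : ∀ a, Ideal.Quotient.mk (Ideal.span {π}) (σ a) = a)
    {Q : OLattice K r → OLattice K r → R} (hQ : IsPairHarmonic hπ Q) (g : GL (Fin r) K) {s : ℕ}
    (hs : 1 ≤ s) (hsr : s ≤ r) :
    ∑ᶠ u : Fin (s - 1) → ResField π,
        Q ((g * unipGL hπ r s fun i => σ (u i)) • stdLattice K r)
          ((g * unipGL hπ r s fun i => σ (u i)) • stdSublattice hπ r) =
      Q ((g * diagGL hπ r s) • stdLattice K r) ((g * diagGL hπ r s) • stdSublattice hπ r) := by
  have h := finsum_unipGL_add hπ hσ hs hsr Q g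
  have h1 : g • stdLattice K r ≤ g • diagGL hπ r s • stdSublattice hπ r :=
    (OLattice.smul_le_smul_iff g).mpr (le_diagGL_smul_stdSublattice hπ hs)
  have h2 : g • diagGL hπ r s • stdSublattice hπ r ≤ g • diagGL hπ r s • stdLattice K r :=
    (OLattice.smul_le_smul_iff g).mpr (diagGL_smul_covBy hπ (hs.trans hsr) s).le
  have h3 : g • diagGL hπ r s • stdLattice K r ≤ (unif hπ)⁻¹ • g • stdLattice K r := by
    rw [smul_comm (unif hπ)⁻¹ g]
    exact (OLattice.smul_le_smul_iff g).mpr (diagGL_smul_le hπ s)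
  rw [hQ.lines h1 (h2.trans h3), hQ.lines (h1.trans h2) h3, hQ.add h1 h2 h3] at h
  rw [mul_smul, mul_smul]
  exact add_right_cancel h

theorem IsPairHarmonic.sum_rotGL {hπ : Irreducible π} {Q : OLattice K r → OLattice K r → R}
    (hQ : IsPairHarmonic hπ Q) (g : GL (Fin r) K) :
    ∑ s : Finset.Icc 1 r, Q ((g * rotGL hπ (Finset.mem_Icc.mp s.2).2) • stdLattice K r)
      ((g * rotGL hπ (Finset.mem_Icc.mp s.2).2) • stdSublattice hπ r) = 0 := by
  rw [sum_rotGL_eq]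
  -- Additivity makes the sum along the flag telescope to `Q(π⁻¹L, L) = 0`.
  have key : ∀ t ≤ r, ∑ u ∈ Finset.range t, Q (rotFlag hπ g (u + 1)) (rotFlag hπ g u) =
      Q (rotFlag hπ g t) (rotFlag hπ g 0) := by
    intro t ht
    induction t with
    | zero => rw [Finset.sum_range_zero, hQ.self_eq_zero]
    | succ t ih =>
      rw [Finset.sum_range_succ, ih (by omega), add_comm]
      refine (hQ.add (rotFlag_mono hπ g (Nat.zero_le t) (by omega))
        (rotFlag_covBy_succ hπ g ht).le ?_).symm
      rw [rotFlag_zero, ← rotFlag_self]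
      exact rotFlag_mono hπ g ht le_rfl
  rw [key r le_rfl, rotFlag_zero, rotFlag_self, hQ.full]

/-- Only finitely many lattices lie between `W'` and `W`, so a maximal one below `W` exists. It
supplies the inductive step of `lineSum_eq_add`. -/
theorem exists_le_covBy (hπ : Irreducible π) {W' W : OLattice K r} (h : W' < W)
    (h' : W ≤ (unif hπ)⁻¹ • W') : ∃ W'', W' ≤ W'' ∧ W'' ⋖ W := by
  obtain ⟨M, hM⟩ := ((finite_Icc hπ h').subset Set.Ico_subset_Icc_self).exists_maximal
    (s := Set.Ico W' W) ⟨W', le_rfl, h⟩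
  exact ⟨M, hM.prop.1, hM.prop.2, fun N hN hN' =>
    hN.not_ge (hM.2 ⟨hM.prop.1.trans hN.le, hN'⟩ hN.le)⟩

/-- After transport to a standard chain, the lines of `W` outside `W'` sum by the first relation to
`f` at `g diag(π I_s, I)`, which is the value on the cover `W' ⋖ W`; the remaining lines are those
of `W'`. -/
theorem lineSum_eq_add_of_covBy {hπ : Irreducible π} {σ : ResField π → 𝒪[K]}
    (hσ : ∀ a, Ideal.Quotient.mk (Ideal.span {π}) (σ a) = a)
    {f : GL (Fin r) K ⧸ scalarParahoric π r 1 → R} (hf : IsHarmonicGL hπ σ f)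
    {L W' W : OLattice K r} (h₁ : L ≤ W') (h₂ : W' ⋖ W) (h₃ : W ≤ (unif hπ)⁻¹ • L) :
    lineSum hπ f W L = lineSum hπ f W W' + lineSum hπ f W' L := by
  obtain ⟨g, s, hs, hsr, rfl, rfl, rfl⟩ := exists_smul_flag_eq hπ h₁ h₂ h₃
  rw [lineSum_of_covBy hπ f h₂, ← mul_smul g (diagGL hπ r s), ← mul_smul g (diagGL hπ r s),
    cosetPair_smul, ← hf.unip g s hs hsr, lineSum, lineSum, mul_smul, mul_smul,
    ← finsum_unipGL_add hπ hσ hs hsr]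
  simp only [cosetPair_smul]

theorem lineSum_eq_add {hπ : Irreducible π} {σ : ResField π → 𝒪[K]}
    (hσ : ∀ a, Ideal.Quotient.mk (Ideal.span {π}) (σ a) = a)
    {f : GL (Fin r) K ⧸ scalarParahoric π r 1 → R} (hf : IsHarmonicGL hπ σ f)
    {L W' : OLattice K r} (h₁ : L ≤ W') :
    ∀ {W : OLattice K r}, W' ≤ W → W ≤ (unif hπ)⁻¹ • L →
      lineSum hπ f W L = lineSum hπ f W W' + lineSum hπ f W' L := by
  suffices H : ∀ (n : ℕ) (W : OLattice K r), (Set.Icc W' W).ncard = n → W' ≤ W →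
      W ≤ (unif hπ)⁻¹ • L → lineSum hπ f W L = lineSum hπ f W W' + lineSum hπ f W' L from
    fun {W} => H _ W rfl
  intro n
  induction n using Nat.strong_induction_on with
  | _ n ih =>
    intro W hn h₂ h₃
    rcases h₂.eq_or_lt with rfl | h₂
    · rw [lineSum_self, zero_add]
    have h₃' : W ≤ (unif hπ)⁻¹ • W' :=
      h₃.trans ((OLattice.units_smul_le_smul_iff _).mpr h₁)
    obtain ⟨W'', h4, h5⟩ := exists_le_covBy hπ h₂ h₃'
    have hlt : (Set.Icc W' W'').ncard < n := by
      rw [← hn]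
      refine Set.ncard_lt_ncard ⟨Set.Icc_subset_Icc_right h5.le, fun h => ?_⟩
        (finite_Icc hπ h₃')
      exact h5.1.not_ge (h ⟨h₂.le, le_rfl⟩).2
    -- With `W' ≤ W'' ⋖ W`, the cover case is applied over both `L` and `W'`, and the induction
    -- hypothesis to `W''`.
    rw [lineSum_eq_add_of_covBy hσ hf (h₁.trans h4) h5 h₃,
      lineSum_eq_add_of_covBy hσ hf h4 h5 h₃', ih _ hlt W'' rfl h4 (h5.le.trans h₃), add_assoc]

theorem IsHarmonicGL.isPairHarmonic {hπ : Irreducible π} {σ : ResField π → 𝒪[K]}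
    (hσ : ∀ a, Ideal.Quotient.mk (Ideal.span {π}) (σ a) = a)
    {f : GL (Fin r) K ⧸ scalarParahoric π r 1 → R} (hf : IsHarmonicGL hπ σ f) :
    IsPairHarmonic hπ (lineSum hπ f) := by
  refine ⟨fun α W L => ?_, fun h1 h2 h3 => lineSum_eq_add hσ hf h1 h2 h3, fun L => ?_,
    fun {L W} _ _ => finsum_mem_congr rfl fun ℓ hℓ => lineSum_of_covBy hπ f hℓ.1⟩
  · exact (finsum_mem_eq_of_bijOn _ (bijOn_units_smul_covers α L W) fun ℓ hℓ =>
      (cosetPair_units_smul hπ f α hℓ.1).symm).symm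
  · obtain ⟨g, rfl⟩ := exists_smul_stdLattice_eq L
    -- Additivity expresses the line sum of `π⁻¹L` over `L` as the sum of `f` along the rotation
    -- flag, which the second relation makes zero.
    have key : ∀ t ≤ r, lineSum hπ f (rotFlag hπ g t) (rotFlag hπ g 0) =
        ∑ u ∈ Finset.range t, cosetPair hπ f (rotFlag hπ g (u + 1)) (rotFlag hπ g u) := by
      intro t ht
      induction t with
      | zero => rw [Finset.sum_range_zero, lineSum_self]
      | succ t ih =>
        have hcov := rotFlag_covBy_succ hπ g ht
        rw [Finset.sum_range_succ, ← ih (by omega), ← lineSum_of_covBy hπ f hcov,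
          add_comm (lineSum _ _ _ _)]
        refine lineSum_eq_add hσ hf (rotFlag_mono hπ g (Nat.zero_le t) (by omega)) hcov.le ?_
        rw [rotFlag_zero, ← rotFlag_self]
        exact rotFlag_mono hπ g ht le_rfl
    rw [← rotFlag_self, ← rotFlag_zero hπ, key r le_rfl, ← sum_rotGL_eq]
    simp only [cosetPair_smul]
    exact hf.rot g

/-- The function `g ↦ h(g e¹)` on `GL_r(K) / Kˣ I^1`. -/
def cosetFunction (hπ : Irreducible π) (hr : 2 ≤ r) (h : OrientedEdge π r → R)
    (x : GL (Fin r) K ⧸ scalarParahoric π r 1) : R :=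
  Quotient.liftOn' x (fun g => h (g • stdEdge hπ le_rfl hr)) fun a b hab => by
    have h1 := scalarParahoric_le_stabilizer hπ hr (QuotientGroup.leftRel_apply.mp hab)
    rw [MulAction.mem_stabilizer_iff, mul_smul, inv_smul_eq_iff] at h1
    exact congrArg h h1.symm

theorem IsHarmonic.isHarmonicGL {hπ : Irreducible π} {σ : ResField π → 𝒪[K]}
    (hσ : ∀ a, Ideal.Quotient.mk (Ideal.span {π}) (σ a) = a) (hr : 2 ≤ r)
    {h : OrientedEdge π r → R} (H : IsHarmonic hπ h) :
    IsHarmonicGL hπ σ (cosetFunction hπ hr h) := by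
  have hQ := H.isPairHarmonic hr
  refine ⟨fun g s hs hsr => ?_, fun g => ?_⟩
  · have := hQ.finsum_unipGL hσ g hs hsr
    simp only [pairFunction_smul_std hπ hr] at this
    exact this
  · have := hQ.sum_rotGL g
    simp only [pairFunction_smul_std hπ hr] at this
    exact this

/-- The map `h ↦ h₁` from harmonic cochains to functions on the group. -/
def cochainToFunction (hπ : Irreducible π) {σ : ResField π → 𝒪[K]}
    (hσ : ∀ a, Ideal.Quotient.mk (Ideal.span {π}) (σ a) = a) (hr : 2 ≤ r) (R : Type*)
    [AddCommGroup R] : harmonicCochains hπ r R →+ harmonicFunctions hπ σ r R where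
  toFun h := ⟨cosetFunction hπ hr h.1, IsHarmonic.isHarmonicGL hσ hr h.2⟩
  map_zero' := Subtype.ext (funext fun x => by
    induction x using QuotientGroup.induction_on with
    | H g => rfl)
  map_add' _ _ := Subtype.ext (funext fun x => by
    induction x using QuotientGroup.induction_on with
    | H g => rfl)

/-- The triangle relation determines a cochain by its values on edges of type 1, all of which are
translates of `e¹`. -/
theorem cochainToFunction_injective (hπ : Irreducible π) {σ : ResField π → 𝒪[K]}
    (hσ : ∀ a, Ideal.Quotient.mk (Ideal.span {π}) (σ a) = a) (hr : 2 ≤ r) :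
    Function.Injective (cochainToFunction hπ hσ hr R) := by
  intro h h' e
  refine Subtype.ext (funext fun e₀ => ?_)
  have H : IsHarmonic hπ h.1 := h.2
  have H' : IsHarmonic hπ h'.1 := h'.2
  rw [← H.triangle, ← H'.triangle]
  refine finsum_mem_congr rfl fun e₁ he₁ => ?_
  obtain ⟨L₀, L₁, hL, rfl⟩ := e₁.exists_eq_mk
  obtain ⟨g, rfl, rfl⟩ :=
    exists_smul_eq_of_covBy hπ ((OrientedEdge.hasType_one_mk_iff hπ hL).mp he₁.1)
  exact congrFun (congrArg Subtype.val e) (QuotientGroup.mk g)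

/-- The preimage is the edge function of `lineSum`. On a translate of `e¹` the line sum has the
single term `f(g)`, because the pair is a cover. -/
theorem cochainToFunction_surjective (hπ : Irreducible π) {σ : ResField π → 𝒪[K]}
    (hσ : ∀ a, Ideal.Quotient.mk (Ideal.span {π}) (σ a) = a) (hr : 2 ≤ r) :
    Function.Surjective (cochainToFunction hπ hσ hr R) := by
  rintro ⟨f, hf⟩
  have hQ := IsHarmonicGL.isPairHarmonic hσ hf
  refine ⟨⟨_, hQ.isHarmonic hr⟩, Subtype.ext (funext fun x => ?_)⟩
  induction x using QuotientGroup.induction_on with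
  | H g =>
    have hcov := (OLattice.smul_covBy_smul_iff g).mpr
      (stdSublattice_covBy hπ (one_le_two.trans hr))
    refine (edgeFunction_mk hQ ((adj_std hπ le_rfl hr).smul g)).trans ?_
    exact (lineSum_of_covBy hπ f hcov).trans (cosetPair_smul hπ f g)

end GroupFunctions

end BruhatTits

end

theorem mainTheorem10 {K : Type*} [Field K] [ValuativeRel K] [TopologicalSpace K]
    [IsNonarchimedeanLocalField K] {π : 𝒪[K]} (hπ : Irreducible π)
    (σ : BruhatTits.ResField π → 𝒪[K]) (hσ : ∀ a, Ideal.Quotient.mk (Ideal.span {π}) (σ a) = a)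
    (r : ℕ) (hr : 2 ≤ r) (R : Type*) [AddCommGroup R] :
    ∃ Φ : BruhatTits.harmonicCochains hπ r R ≃+ BruhatTits.harmonicFunctions hπ σ r R,
      (∀ (h : BruhatTits.harmonicCochains hπ r R) (g : GL (Fin r) K),
        (Φ h).1 (QuotientGroup.mk g) = h.1 (g • BruhatTits.stdEdge hπ le_rfl hr)) ∧
      (∀ (γ : GL (Fin r) K) (h : BruhatTits.harmonicCochains hπ r R), Φ (γ • h) = γ • Φ h) := by
  refine ⟨AddEquiv.ofBijective (BruhatTits.cochainToFunction hπ hσ hr R)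
    ⟨BruhatTits.cochainToFunction_injective hπ hσ hr,
      BruhatTits.cochainToFunction_surjective hπ hσ hr⟩, fun h g => rfl, fun γ h => ?_⟩
  refine Subtype.ext (funext fun x => ?_)
  induction x using QuotientGroup.induction_on with
  | H g => exact congrArg h.1 (mul_smul γ⁻¹ g _).symm
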